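/- Let $q$ be a complex number with $0<|q|<1$. Write $(z;q)_\infty=\prod_{k=0}^\infty(1-zq^k)$, $(z_1,z_2;q)_\infty=(z_1;q)_\infty(z_2;q)_\infty$, $[z;q]_\infty=(z,q/z;q)_\infty$, $$ST(z,q)=\sum_{n=1}^\infty\frac{q^n(q^{2n};q)_\infty}{(zq^n,z^{-1}q^n;q)_\infty},\qquad \Sigma(z,w,q)=\sum_{n=-\infty}^\infty\frac{q^{2n(n+1)}w^n}{1-zq^n},$$ and, for integers $a,b,c$, abbreviate $\Sigma(a,b,c)=\Sigma(q^a,q^b,q^c)$ (a function of $q$). Let $\zeta_3$ be a primitive third root of unity. Then $ST(\zeta_3,q)$ and the series $\Sigma$ below converge, and $$ST(\zeta_3,q)=A_0(q^3)+qA_1(q^3)+q^2A_2(q^3),$$ where $$A_0(q)=\frac{(q^9;q^9)_\infty[q^3;q^9]_\infty}{[q;q^9]_\infty^2[q^4;q^9]_\infty}-\frac{\Sigma(1,-14,9)+q\,\Sigma(1,-5,9)}{(q^9;q^9)_\infty[q^2;q^9]_\infty}-\frac{q\,\Sigma(1,-8,9)+q^5\,\Sigma(4,1,9)}{(q^9;q^9)_\infty[q^4;q^9]_\infty},$$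 $$A_1(q)=\frac{(q^3;q^3)_\infty}{[q;q^3]_\infty},\qquad A_2(q)=0.$$ -/

import Mathlib

noncomputable section

namespace PartitionPairs

/-- The infinite `q`-Pochhammer symbol `(z; q)_∞ = ∏_{k ≥ 0} (1 - z q^k)`. -/
def qPoch (z q : ℂ) : ℂ := ∏' k : ℕ, (1 - z * q ^ k)

/-- The product defining `(z; q)_∞` converges for `|q| < 1`. -/
theorem multipliable_qPoch (z : ℂ) {q : ℂ} (hq : ‖q‖ < 1) :
    Multipliable (fun k : ℕ => 1 - z * q ^ k) := by
  have h : Summable (fun k : ℕ => ‖-(z * q ^ k)‖) := by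
    simp only [norm_neg, norm_mul, norm_pow]
    exact (summable_geometric_of_lt_one (norm_nonneg q) hq).mul_left ‖z‖
  simpa [sub_eq_add_neg] using multipliable_one_add_of_summable h

/-- The theta product `[z; q]_∞ = (z, q/z; q)_∞`, for `z ≠ 0`. -/
def jacProd (z q : ℂ) : ℂ := qPoch z q * qPoch (q / z) q

/-- The `n`-th term `q^n (q^{2n}; q)_∞ / (z q^n, z⁻¹ q^n; q)_∞` of `ST(z, q)`. -/
def STTerm (z q : ℂ) (n : ℕ) : ℂ :=
  q ^ n * qPoch (q ^ (2 * n)) q / (qPoch (z * q ^ n) q * qPoch (z⁻¹ * q ^ n) q)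

/-- `ST(z, q)`, the sum of the terms above over `n ≥ 1`. -/
def ST (z q : ℂ) : ℂ := ∑' n : ℕ, STTerm z q (n + 1)

/-- The `n`-th term `q^{2n(n+1)} w^n / (1 - z q^n)` of `Σ(z, w, q)`, for `n ∈ ℤ`. -/
def SigmaTerm (z w q : ℂ) (n : ℤ) : ℂ :=
  q ^ (2 * n * (n + 1)) * w ^ n / (1 - z * q ^ n)

/-- The bilateral series `Σ(z, w, q)`. -/
def SigmaSeries (z w q : ℂ) : ℂ := ∑' n : ℤ, SigmaTerm z w q n

/-- `Σ(a, b, c) = Σ(q^a, q^b, q^c)` for integers `a, b, c`. -/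
def SigmaInt (q : ℂ) (a b c : ℤ) : ℂ := SigmaSeries (q ^ a) (q ^ b) (q ^ c)

/-- The component `A₀` of the dissection. -/
def A0 (q : ℂ) : ℂ :=
  qPoch (q ^ 9) (q ^ 9) * jacProd (q ^ 3) (q ^ 9) /
      (jacProd q (q ^ 9) ^ 2 * jacProd (q ^ 4) (q ^ 9))
    - 1 / (qPoch (q ^ 9) (q ^ 9) * jacProd (q ^ 2) (q ^ 9)) *
      (SigmaInt q 1 (-14) 9 + q * SigmaInt q 1 (-5) 9)
    - 1 / (qPoch (q ^ 9) (q ^ 9) * jacProd (q ^ 4) (q ^ 9)) *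
      (q * SigmaInt q 1 (-8) 9 + q ^ 5 * SigmaInt q 4 1 9)

/-- The component `A₁` of the dissection. -/
def A1 (q : ℂ) : ℂ := qPoch (q ^ 3) (q ^ 3) / jacProd q (q ^ 3)

/-- The component `A₂` of the dissection, which vanishes identically. -/
def A2 (_q : ℂ) : ℂ := 0

end PartitionPairs

end

/-!
The proof compares, after multiplication by `(q; q)_∞`, two expressions for `ST(ζ, q)`.

* The series `ST(z, q)` is a Bailey-type sum with `β_n = 1 / (q; q)_{2n-1}`. The corresponding
  Bailey pair has a coefficient only at the indices `3r + 1` (`tsum_baileyTerm`, proved by a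
  telescoping certificate), and the conjugate pair needed here is a `q`-Gauss sum whose partial
  sums telescope (`sum_pairFin_mul_qTail`). This gives the bilateral series `qPoch_mul_ST`. At a
  primitive cube root of unity its denominators become `1 - q^{9r+3}`, and splitting `r` modulo `3`
  sorts the series by residues of exponents (`hasSum_trisect`). Each class is a combination of
  Lambert series `∑ Q^{18n²+en} / (1 - Q^{9n+b})` with `Q = q³`.
* Jacobi's triple product trisects `(q; q)_∞` (`qPoch_self_trisect`). Comparing residue classes,
  it remains to prove three identities in `Q` (`trisection_components`).

These identities come from the partial fraction expansion of `1 / ([b₁] [b₂] [b₃] [b₄])`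
(`partialFraction`), obtained as the limit of Lagrange interpolation at the nodes `b_j p^k`,
`|k| ≤ N`. Four choices of the poles, with `p = Q⁹`, produce four linear relations between the
Lambert series. After their use only theta products are left, and these agree by the cubic
relation `jacNine_cubic`, a case of Weierstrass's three-term relation, which in turn is a Plücker
relation because `θ(xy) θ(x/y)` splits as a sum of two products (`theta_mul_theta`).
-/

noncomputable section

open Filter Topology Finset

namespace PartitionPairs

/-! ### Pochhammer symbols -/

theorem qPoch_eq_mul (z : ℂ) {q : ℂ} (hq : ‖q‖ < 1) :
    qPoch z q = (1 - z) * qPoch (z * q) q := by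
  have h : (fun k : ℕ => 1 - z * q * q ^ k) = fun k : ℕ => 1 - z * q ^ (k + 1) := by
    funext k; ring
  have hm := multipliable_qPoch (z * q) hq
  rw [h] at hm
  have := tprod_eq_zero_mul' (f := fun k : ℕ => 1 - z * q ^ k) hm
  unfold qPoch
  rw [this, h, pow_zero, mul_one]

/-- The finite `q`-Pochhammer symbol `(z; q)_n = ∏_{k < n} (1 - z q^k)`. -/
def qPochFin (z q : ℂ) (n : ℕ) : ℂ := ∏ k ∈ range n, (1 - z * q ^ k)

theorem qPochFin_succ (z q : ℂ) (n : ℕ) :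
    qPochFin z q (n + 1) = qPochFin z q n * (1 - z * q ^ n) := prod_range_succ _ _

theorem qPochFin_succ' (z q : ℂ) (n : ℕ) :
    qPochFin z q (n + 1) = (1 - z) * qPochFin (z * q) q n := by
  simp [qPochFin, prod_range_succ', pow_succ', mul_assoc, mul_comm]

theorem qPochFin_mul_qPoch (z : ℂ) {q : ℂ} (hq : ‖q‖ < 1) (n : ℕ) :
    qPochFin z q n * qPoch (z * q ^ n) q = qPoch z q := by
  induction n with
  | zero => simp [qPochFin]
  | succ n ih =>
    rw [← ih, qPochFin_succ, qPoch_eq_mul (z * q ^ n) hq]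
    ring_nf

theorem tendsto_qPochFin (z : ℂ) {q : ℂ} (hq : ‖q‖ < 1) :
    Tendsto (qPochFin z q) atTop (𝓝 (qPoch z q)) :=
  (multipliable_qPoch z hq).hasProd.tendsto_prod_nat

theorem qPoch_ne_zero {z q : ℂ} (hq : ‖q‖ < 1) (h : ∀ k : ℕ, 1 - z * q ^ k ≠ 0) :
    qPoch z q ≠ 0 := by
  unfold qPoch
  have := tprod_one_add_ne_zero_of_summable (f := fun k : ℕ => -(z * q ^ k))
    (by simpa [sub_eq_add_neg] using h)
    (by
      simp only [norm_neg, norm_mul, norm_pow]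
      exact (summable_geometric_of_lt_one (norm_nonneg q) hq).mul_left ‖z‖)
  simpa [sub_eq_add_neg] using this

theorem qPochFin_ne_zero {z q : ℂ} (h : ∀ k : ℕ, 1 - z * q ^ k ≠ 0) (n : ℕ) :
    qPochFin z q n ≠ 0 := prod_ne_zero_iff.2 fun k _ => h k

theorem exists_norm_qPochFin_le (z : ℂ) {q : ℂ} (hq : ‖q‖ < 1) :
    ∃ C, ∀ n, ‖qPochFin z q n‖ ≤ C := by
  obtain ⟨C, hC⟩ := (tendsto_qPochFin z hq).norm.bddAbove_range
  exact ⟨C, fun n => hC ⟨n, rfl⟩⟩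

/-- Convergence to a nonzero limit keeps the reciprocals of `(z; q)_n` bounded. -/
theorem exists_norm_inv_qPochFin_le {z q : ℂ} (hq : ‖q‖ < 1)
    (h : ∀ k : ℕ, 1 - z * q ^ k ≠ 0) : ∃ C, ∀ n, ‖(qPochFin z q n)⁻¹‖ ≤ C := by
  obtain ⟨C, hC⟩ :=
    ((tendsto_qPochFin z hq).inv₀ (qPoch_ne_zero hq h)).norm.bddAbove_range
  exact ⟨C, fun n => hC ⟨n, rfl⟩⟩

theorem pow_ne_one_of_norm_lt_one {q : ℂ} (hq : ‖q‖ < 1) {n : ℕ} (hn : n ≠ 0) : q ^ n ≠ 1 := by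
  intro h
  have := pow_lt_one₀ (norm_nonneg q) hq hn
  rw [← norm_pow, h, norm_one] at this
  exact this.false

theorem zpow_ne_one_of_norm_lt_one {q : ℂ} (hq : ‖q‖ < 1) {n : ℤ} (hn : n ≠ 0) :
    q ^ n ≠ 1 := by
  obtain ⟨m, rfl | rfl⟩ := n.eq_nat_or_neg
  · rw [zpow_natCast]; exact pow_ne_one_of_norm_lt_one hq (by simpa using hn)
  · rw [zpow_neg, zpow_natCast, ne_eq, inv_eq_one]
    exact pow_ne_one_of_norm_lt_one hq (by simpa using hn)

/-- The tail `(q^{m+1}; q)_∞`, for `m ∈ ℤ`. It equals `(q; q)_∞ / (q; q)_m` for `m ≥ 0` and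
vanishes for `m < 0`, so it stands for a reciprocal `q`-factorial defined on all of `ℤ`. -/
def qTail (q : ℂ) (m : ℤ) : ℂ := qPoch (q ^ (m + 1)) q

section
variable {q : ℂ}

theorem qTail_sub_one (hq0 : q ≠ 0) (hq : ‖q‖ < 1) (m : ℤ) :
    qTail q (m - 1) = (1 - q ^ m) * qTail q m := by
  unfold qTail
  rw [qPoch_eq_mul _ hq, sub_add_cancel, zpow_add_one₀ hq0]

theorem qTail_of_neg (hq0 : q ≠ 0) (hq : ‖q‖ < 1) {m : ℤ} (hm : m < 0) : qTail q m = 0 := by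
  have key : ∀ k : ℕ, qTail q (-1 - k) = 0 := by
    intro k
    induction k with
    | zero => simpa using qTail_sub_one hq0 hq 0
    | succ k ih =>
      have := qTail_sub_one hq0 hq (-1 - k)
      rw [ih, mul_zero] at this
      rw [← this]; congr 1; push_cast; ring
  have := key (-1 - m).toNat
  rwa [Int.toNat_of_nonneg (by omega), sub_sub_cancel] at this

theorem one_sub_mul_pow_self_ne_zero (hq : ‖q‖ < 1) (k : ℕ) : 1 - q * q ^ k ≠ 0 := by
  rw [← pow_succ']
  exact sub_ne_zero.2 (pow_ne_one_of_norm_lt_one hq k.succ_ne_zero).symm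

theorem qPoch_self_ne_zero (hq : ‖q‖ < 1) : qPoch q q ≠ 0 :=
  qPoch_ne_zero hq (one_sub_mul_pow_self_ne_zero hq)

theorem qTail_zero : qTail q 0 = qPoch q q := by simp [qTail]

theorem qTail_natCast (hq : ‖q‖ < 1) (n : ℕ) :
    qTail q n = qPoch q q * (qPochFin q q n)⁻¹ := by
  have h := qPochFin_mul_qPoch q hq n
  have h1 := qPochFin_ne_zero (one_sub_mul_pow_self_ne_zero hq) n
  have : qTail q n = qPoch (q * q ^ n) q := by
    unfold qTail; congr 1; rw [← pow_succ']; norm_cast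
  rw [this, ← h]; field_simp

theorem exists_norm_qTail_le (hq0 : q ≠ 0) (hq : ‖q‖ < 1) :
    ∃ C, ∀ m : ℤ, ‖qTail q m‖ ≤ C := by
  obtain ⟨C, hC⟩ := exists_norm_inv_qPochFin_le hq (one_sub_mul_pow_self_ne_zero hq)
  refine ⟨‖qPoch q q‖ * C, fun m => ?_⟩
  have hC0 : 0 ≤ C := (norm_nonneg _).trans (hC 0)
  rcases lt_or_ge m 0 with hm | hm
  · rw [qTail_of_neg hq0 hq hm, norm_zero]; positivity
  · lift m to ℕ using hm
    rw [qTail_natCast hq, norm_mul]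
    gcongr; exact hC m

theorem tendsto_qTail (hq : ‖q‖ < 1) : Tendsto (qTail q) atTop (𝓝 1) := by
  rw [← Nat.map_cast_int_atTop, tendsto_map'_iff]
  have h0 := qPoch_self_ne_zero hq
  have := ((tendsto_qPochFin q hq).inv₀ h0).const_mul (qPoch q q)
  rw [mul_inv_cancel₀ h0] at this
  exact this.congr fun n => (qTail_natCast hq n).symm

end

/-! ### Quadratic exponential series over the integers -/

/-- The basic convergence fact: `∑_{n ∈ ℤ} p^{n(n-1)/2} w^n` converges absolutely. -/
theorem summable_pow_choose_mul_zpow {p w : ℂ} (hp0 : p ≠ 0) (hp : ‖p‖ < 1) (hw : w ≠ 0) :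
    Summable fun n : ℤ => ‖p ^ (n * (n - 1) / 2) * w ^ n‖ := by
  have main : ∀ u : ℂ, u ≠ 0 → Summable fun n : ℕ => ‖p ^ ((n : ℤ) * (n - 1) / 2) * u ^ n‖ := by
    intro u hu
    have hne : ∀ n : ℕ, p ^ ((n : ℤ) * (n - 1) / 2) * u ^ n ≠ 0 := fun n =>
      mul_ne_zero (zpow_ne_zero _ hp0) (pow_ne_zero _ hu)
    refine summable_of_ratio_test_tendsto_lt_one (l := 0) one_pos
      (Eventually.of_forall fun n => norm_ne_zero_iff.2 (hne n)) ?_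
    have : Tendsto (fun n : ℕ => ‖p‖ ^ n * ‖u‖) atTop (𝓝 (0 * ‖u‖)) :=
      (tendsto_pow_atTop_nhds_zero_of_lt_one (norm_nonneg p) hp).mul_const _
    rw [zero_mul] at this
    refine this.congr fun n => ?_
    rw [norm_norm, norm_norm, ← norm_div, ← norm_pow, ← norm_mul]
    congr 1
    have e : ((n + 1 : ℕ) : ℤ) * ((n + 1 : ℕ) - 1) / 2 = (n : ℤ) * (n - 1) / 2 + n := by
      have : ((n + 1 : ℕ) : ℤ) * ((n + 1 : ℕ) - 1) = (n : ℤ) * (n - 1) + n * 2 := by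
        push_cast; ring
      rw [this, Int.add_mul_ediv_right _ _ two_ne_zero]
    rw [e, zpow_add₀ hp0, zpow_natCast, pow_succ]
    have := hne n
    field_simp
  refine Summable.of_nat_of_neg ?_ ?_
  · simpa using main w hw
  · refine (main (p * w⁻¹) (mul_ne_zero hp0 (inv_ne_zero hw))).congr fun n => ?_
    have e : -(n : ℤ) * (-n - 1) / 2 = (n : ℤ) * (n - 1) / 2 + n := by
      have : -(n : ℤ) * (-n - 1) = (n : ℤ) * (n - 1) + n * 2 := by ring
      rw [this, Int.add_mul_ediv_right _ _ two_ne_zero]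
    rw [e, zpow_add₀ hp0, zpow_neg, zpow_natCast, zpow_natCast, mul_pow, inv_pow, mul_assoc]

theorem summable_pow_quadratic_mul_zpow {p w : ℂ} (hp0 : p ≠ 0) (hp : ‖p‖ < 1) (hw : w ≠ 0)
    {a : ℕ} (ha : a ≠ 0) (b : ℤ) :
    Summable fun n : ℤ => ‖p ^ (a * n ^ 2 + b * n) * w ^ n‖ := by
  have h1 : ‖p ^ (2 * a)‖ < 1 := by
    rw [norm_pow]; exact pow_lt_one₀ (norm_nonneg p) hp (by omega)
  refine (summable_pow_choose_mul_zpow (pow_ne_zero (2 * a) hp0) h1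
    (mul_ne_zero (zpow_ne_zero (a + b) hp0) hw)).congr fun n => ?_
  congr 1
  rw [mul_zpow, ← mul_assoc, ← zpow_natCast, ← zpow_mul, ← zpow_mul, ← zpow_add₀ hp0]
  congr 2
  have : n * (n - 1) / 2 * 2 = n * (n - 1) := Int.ediv_mul_cancel (Int.even_mul_pred_self n).two_dvd
  push_cast
  linear_combination (a : ℤ) * this

/-- The factors `1 / (1 - z p^n)` are bounded: they tend to `1` at `+∞` and to `0` at `-∞`, and a
vanishing denominator contributes the value `0`. -/
theorem exists_norm_inv_one_sub_le {p z : ℂ} (hp0 : p ≠ 0) (hp : ‖p‖ < 1) (hz0 : z ≠ 0) :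
    ∃ C, ∀ n : ℤ, ‖(1 - z * p ^ n)⁻¹‖ ≤ C := by
  have hpow := tendsto_pow_atTop_nhds_zero_of_norm_lt_one hp
  have h1 : Tendsto (fun n : ℕ => ‖(1 - z * p ^ n)⁻¹‖) atTop (𝓝 ‖(1 - z * 0)⁻¹‖) :=
    ((tendsto_const_nhds.sub (hpow.const_mul z)).inv₀ (by simp)).norm
  have h2 : Tendsto (fun n : ℕ => ‖p ^ n * (p ^ n - z)⁻¹‖) atTop (𝓝 ‖0 * (0 - z)⁻¹‖) :=
    (hpow.mul ((hpow.sub_const z).inv₀ (by simpa using hz0))).norm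
  obtain ⟨C1, hC1⟩ := h1.bddAbove_range
  obtain ⟨C2, hC2⟩ := h2.bddAbove_range
  refine ⟨max C1 C2, fun n => ?_⟩
  obtain ⟨m, rfl | rfl⟩ := n.eq_nat_or_neg
  · rw [zpow_natCast]; exact (hC1 ⟨m, rfl⟩).trans (le_max_left _ _)
  · refine le_trans (le_of_eq ?_) ((hC2 ⟨m, rfl⟩).trans (le_max_right _ _))
    congr 1
    have := pow_ne_zero m hp0
    rw [zpow_neg, zpow_natCast, ← inv_inv (p ^ m), ← mul_inv, inv_inv]
    congr 1
    field_simp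

theorem summable_pow_quadratic_div {p w z : ℂ} (hp0 : p ≠ 0) (hp : ‖p‖ < 1) (hw : w ≠ 0)
    (hz : z ≠ 0) {a : ℕ} (ha : a ≠ 0) (b : ℤ) :
    Summable fun n : ℤ => ‖p ^ (a * n ^ 2 + b * n) * w ^ n / (1 - z * p ^ n)‖ := by
  obtain ⟨C, hC⟩ := exists_norm_inv_one_sub_le hp0 hp hz
  refine Summable.of_nonneg_of_le (fun _ => norm_nonneg _) (fun n => ?_)
    ((summable_pow_quadratic_mul_zpow hp0 hp hw ha b).mul_right C)
  rw [div_eq_mul_inv, norm_mul]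
  gcongr
  exact hC n

theorem summable_norm_SigmaTerm {z w q : ℂ} (hq0 : q ≠ 0) (hq : ‖q‖ < 1) (hw : w ≠ 0)
    (hz : z ≠ 0) : Summable fun n : ℤ => ‖SigmaTerm z w q n‖ := by
  refine (summable_pow_quadratic_div hq0 hq hw hz two_ne_zero 2).congr fun n => ?_
  unfold SigmaTerm
  congr 4
  push_cast; ring

/-! ### The Bailey pair and the bilateral series for `ST` -/

section
variable {q : ℂ}

/-- The coefficient at index `3r + 1` of the Bailey pair relative to `1` with
`β_n = 1 / (q; q)_{2n-1}`; all other coefficients vanish. -/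
def baileyCoeff (q : ℂ) (r : ℤ) : ℂ := q ^ (6 * r ^ 2 + r) * (1 - q ^ (6 * r + 2))

/-- The summand of the Bailey pair relation, each `1 / (q; q)_m` being scaled by `(q; q)_∞`. -/
def baileyTerm (q : ℂ) (n r : ℤ) : ℂ :=
  baileyCoeff q r * (qTail q (n - (3 * r + 1)) * qTail q (n + (3 * r + 1)))

theorem baileyTerm_eq_zero (hq0 : q ≠ 0) (hq : ‖q‖ < 1) {n r : ℤ} (hr : r ∉ Icc (-n) n) :
    baileyTerm q n r = 0 := by
  rw [mem_Icc, not_and_or] at hr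
  unfold baileyTerm
  rcases lt_or_ge (n - (3 * r + 1)) 0 with h | h
  · rw [qTail_of_neg hq0 hq h]; ring
  · rw [qTail_of_neg hq0 hq (m := n + (3 * r + 1)) (by omega)]; ring

theorem summable_baileyTerm (hq0 : q ≠ 0) (hq : ‖q‖ < 1) (n : ℤ) :
    Summable (baileyTerm q n) :=
  summable_of_ne_finset_zero (s := Icc (-n) n) fun _ hr => baileyTerm_eq_zero hq0 hq hr

/-- The certificate `G` for which the recurrence operator in `n`, applied to `baileyTerm`, equals
`G(r + 1) - G(r)`; see `baileyTerm_telescope`. -/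
def baileyCert (q : ℂ) (n r : ℤ) : ℂ :=
  -q ^ (6 * r ^ 2 - 2 * r - 1 + n) * (qTail q (n - 3 * r - 1) * qTail q (n + 3 * r - 2))

theorem baileyCert_eq_zero (hq0 : q ≠ 0) (hq : ‖q‖ < 1) {n r : ℤ} (hr : r ∉ Icc (-n) n) :
    baileyCert q n r = 0 := by
  rw [mem_Icc, not_and_or] at hr
  unfold baileyCert
  rcases lt_or_ge (n - 3 * r - 1) 0 with h | h
  · rw [qTail_of_neg hq0 hq h]; ring
  · rw [qTail_of_neg hq0 hq (m := n + 3 * r - 2) (by omega)]; ring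

theorem baileyTerm_telescope (hq0 : q ≠ 0) (hq : ‖q‖ < 1) (n r : ℤ) :
    (1 - q ^ (2 * n - 1)) * (1 - q ^ (2 * n - 2)) * baileyTerm q n r - baileyTerm q (n - 1) r
      = baileyCert q n (r + 1) - baileyCert q n r := by
  have s := qTail_sub_one hq0 hq
  have a1 : qTail q (n - 1 - (3 * r + 1))
      = (1 - q ^ (n - 3 * r - 1)) * qTail q (n - (3 * r + 1)) := by
    rw [show n - (3 * r + 1) = n - 3 * r - 1 by ring, ← s]; congr 1; ring
  have a2 : qTail q (n - 3 * (r + 1) - 1) = (1 - q ^ (n - 3 * r - 3)) *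
      ((1 - q ^ (n - 3 * r - 2)) * ((1 - q ^ (n - 3 * r - 1)) * qTail q (n - (3 * r + 1)))) := by
    rw [← a1, show n - 1 - (3 * r + 1) = n - 3 * r - 2 by ring, ← s,
      show n - 3 * r - 2 - 1 = n - 3 * r - 3 by ring, ← s]
    congr 1; ring
  have b1 : qTail q (n - 1 + (3 * r + 1))
      = (1 - q ^ (n + 3 * r + 1)) * qTail q (n + (3 * r + 1)) := by
    rw [show n + (3 * r + 1) = n + 3 * r + 1 by ring, ← s]; congr 1; ring
  have b2 : qTail q (n + 3 * r - 2) = (1 - q ^ (n + 3 * r - 1)) *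
      ((1 - q ^ (n + 3 * r)) * ((1 - q ^ (n + 3 * r + 1)) * qTail q (n + (3 * r + 1)))) := by
    rw [← b1, show n - 1 + (3 * r + 1) = n + 3 * r by ring, ← s, ← s]
    congr 1; ring
  unfold baileyTerm baileyCert baileyCoeff
  rw [a1, a2, b1, b2, show n - 3 * r - 1 = n - (3 * r + 1) by ring,
    show n + 3 * (r + 1) - 2 = n + (3 * r + 1) by ring]
  generalize qTail q (n - (3 * r + 1)) = A
  generalize qTail q (n + (3 * r + 1)) = B
  rw [show 6 * (r + 1) ^ 2 - 2 * (r + 1) - 1 + n = 6 * r ^ 2 + 10 * r + 3 + n by ring]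
  have e : ∀ k : ℤ, q ^ (k * r) = (q ^ r) ^ k := fun k => by rw [mul_comm, zpow_mul]
  have e' : ∀ k : ℤ, q ^ (k * n) = (q ^ n) ^ k := fun k => by rw [mul_comm, zpow_mul]
  have hx := zpow_ne_zero r hq0
  have hy := zpow_ne_zero n hq0
  have hw := zpow_ne_zero (6 * r ^ 2) hq0
  simp only [zpow_add₀ hq0, zpow_sub₀ hq0, e, e']
  generalize q ^ r = x at *
  generalize q ^ n = y at *
  generalize q ^ (6 * r ^ 2) = w at *
  simp only [zpow_ofNat]
  field_simp
  ring

theorem sum_baileyTerm_recurrence (hq0 : q ≠ 0) (hq : ‖q‖ < 1) (n : ℤ) :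
    (1 - q ^ (2 * n - 1)) * (1 - q ^ (2 * n - 2)) * ∑' r, baileyTerm q n r
      = ∑' r, baileyTerm q (n - 1) r := by
  have hG : Summable (baileyCert q n) :=
    summable_of_ne_finset_zero (s := Icc (-n) n) fun _ hr => baileyCert_eq_zero hq0 hq hr
  have hG' : Summable fun r => baileyCert q n (r + 1) :=
    (Equiv.addRight (1 : ℤ)).summable_iff.2 hG
  have h0 : ∑' r, (baileyCert q n (r + 1) - baileyCert q n r) = 0 := by
    rw [hG'.tsum_sub hG, sub_eq_zero]
    exact (Equiv.addRight (1 : ℤ)).tsum_eq (baileyCert q n)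
  simp only [← baileyTerm_telescope hq0 hq] at h0
  rw [((summable_baileyTerm hq0 hq n).mul_left _).tsum_sub (summable_baileyTerm hq0 hq _),
    tsum_mul_left, sub_eq_zero] at h0
  exact h0

/-- The Bailey pair relation `∑_r α_{3r+1} / ((q)_{n-3r-1} (q)_{n+3r+1}) = 1 / (q)_{2n-1}`. -/
theorem tsum_baileyTerm (hq0 : q ≠ 0) (hq : ‖q‖ < 1) (n : ℕ) :
    ∑' r, baileyTerm q n r = qPoch q q * qTail q (2 * n - 1) := by
  induction n with
  | zero =>
    rw [qTail_of_neg hq0 hq (m := 2 * ((0 : ℕ) : ℤ) - 1) (by simp), mul_zero]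
    refine (tsum_congr fun r => ?_).trans tsum_zero
    unfold baileyTerm
    rcases lt_or_ge (3 * r + 1) 0 with h | h
    · rw [qTail_of_neg hq0 hq (m := ((0 : ℕ) : ℤ) + _) (by simpa using h)]; ring
    · rw [qTail_of_neg hq0 hq (m := ((0 : ℕ) : ℤ) - _) (by push_cast; omega)]; ring
  | succ n ih =>
    rcases Nat.eq_zero_or_pos n with rfl | hn
    -- the recurrence degenerates at `n = 1`, where its leading coefficient vanishes
    · rw [tsum_eq_single 0]
      · have h := qTail_sub_one hq0 hq 2
        norm_num at h
        simp only [baileyTerm, baileyCoeff]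
        norm_num
        rw [h, qTail_zero]; ring
      · intro r hr
        unfold baileyTerm
        rcases lt_or_ge r 0 with h | h
        · rw [qTail_of_neg hq0 hq (m := _ + (3 * r + 1)) (by push_cast; omega)]; ring
        · rw [qTail_of_neg hq0 hq (m := _ - (3 * r + 1)) (by push_cast; omega)]; ring
    · have h := sum_baileyTerm_recurrence hq0 hq (n + 1)
      rw [add_sub_cancel_right, ih] at h
      have h1 : 1 - q ^ (2 * ((n : ℤ) + 1) - 1) ≠ 0 :=
        sub_ne_zero.2 (zpow_ne_one_of_norm_lt_one hq (by omega)).symm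
      have h2 : 1 - q ^ (2 * ((n : ℤ) + 1) - 2) ≠ 0 :=
        sub_ne_zero.2 (zpow_ne_one_of_norm_lt_one hq (by omega)).symm
      refine mul_left_cancel₀ (mul_ne_zero h1 h2) ?_
      push_cast
      rw [h, show (2 * (n : ℤ) - 1) = 2 * (n + 1) - 1 - 1 - 1 by ring, qTail_sub_one hq0 hq,
        qTail_sub_one hq0 hq, show 2 * ((n : ℤ) + 1) - 1 - 1 = 2 * (n + 1) - 2 by ring]
      ring

end

/-- The product `(z, 1/z; q)_n` of finite Pochhammer symbols. -/
def pairFin (z q : ℂ) (n : ℕ) : ℂ := qPochFin z q n * qPochFin z⁻¹ q n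

/-- The kernel `q^k / ((1 - z q^k)(1 - q^k / z))` produced by Bailey's lemma. -/
def baileyKernel (z q : ℂ) (k : ℤ) : ℂ := q ^ k / ((1 - z * q ^ k) * (1 - z⁻¹ * q ^ k))

section
variable {z q : ℂ}

theorem one_sub_mul_zpow_ne_zero (hz : z ≠ 0) (hq0 : q ≠ 0)
    (h1 : ∀ k : ℕ, 1 - z * q ^ k ≠ 0) (h2 : ∀ k : ℕ, 1 - z⁻¹ * q ^ k ≠ 0) (k : ℤ) :
    1 - z * q ^ k ≠ 0 := by
  obtain ⟨m, rfl | rfl⟩ := k.eq_nat_or_neg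
  · rw [zpow_natCast]; exact h1 m
  · have := h2 m
    have hqm := pow_ne_zero m hq0
    rw [zpow_neg, zpow_natCast]
    contrapose! this
    field_simp at this ⊢
    linear_combination -this

/-- The summable `q`-Gauss sum behind Bailey's lemma, in its telescoped finite form. -/
theorem sum_pairFin_mul_qTail (hz : z ≠ 0) (hq0 : q ≠ 0) (hq : ‖q‖ < 1)
    (h1 : ∀ k : ℕ, 1 - z * q ^ k ≠ 0) (h2 : ∀ k : ℕ, 1 - z⁻¹ * q ^ k ≠ 0) (k : ℤ) (N : ℕ) :
    ∑ n ∈ range N, q ^ n * pairFin z q n * (qTail q (n - k) * qTail q (n + k))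
      = pairFin z q N * (qTail q (N - 1 - k) * qTail q (N - 1 + k)) * baileyKernel z q k := by
  induction N with
  | zero =>
    rcases lt_or_ge k 0 with h | h
    · rw [qTail_of_neg hq0 hq (m := ((0 : ℕ) : ℤ) - 1 + k) (by push_cast; omega)]; simp
    · rw [qTail_of_neg hq0 hq (m := ((0 : ℕ) : ℤ) - 1 - k) (by push_cast; omega)]; simp
  | succ N ih =>
    have ha := one_sub_mul_zpow_ne_zero hz hq0 h1 h2 k
    have hb := one_sub_mul_zpow_ne_zero (inv_ne_zero hz) hq0 h2 (by simpa using h1) k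
    rw [sum_range_succ, ih, show ((N : ℤ) - 1 - k) = N - k - 1 by ring,
      show ((N : ℤ) - 1 + k) = N + k - 1 by ring, qTail_sub_one hq0 hq, qTail_sub_one hq0 hq]
    push_cast
    rw [add_sub_cancel_right]
    unfold pairFin baileyKernel
    rw [qPochFin_succ, qPochFin_succ, zpow_sub₀ hq0, zpow_add₀ hq0, zpow_natCast]
    have hk := zpow_ne_zero k hq0
    generalize qTail q (N - k) = A
    generalize qTail q (N + k) = B
    generalize q ^ N = y
    generalize q ^ k = x at *
    have hb' : z - x ≠ 0 := by
      contrapose! hb; rw [sub_eq_zero] at hb; subst hb; field_simp; simp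
    field_simp
    ring

/-- The terms of `ST` as Bailey-type terms with `β_n = 1 / (q; q)_{2n-1}`. -/
theorem STTerm_eq (hq : ‖q‖ < 1) (h1 : ∀ k : ℕ, 1 - z * q ^ k ≠ 0)
    (h2 : ∀ k : ℕ, 1 - z⁻¹ * q ^ k ≠ 0) (n : ℕ) :
    STTerm z q n = q ^ n * pairFin z q n * qTail q (2 * n - 1)
      * (qPoch z q * qPoch z⁻¹ q)⁻¹ := by
  have hz1 := qPochFin_ne_zero h1 n
  have hz2 := qPochFin_ne_zero h2 n
  have e : qTail q (2 * n - 1) = qPoch (q ^ (2 * n)) q := by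
    unfold qTail; rw [sub_add_cancel]; norm_cast
  unfold STTerm pairFin
  rw [e, ← qPochFin_mul_qPoch z hq n, ← qPochFin_mul_qPoch z⁻¹ hq n]
  by_cases ha : qPoch (z * q ^ n) q = 0
  · simp [ha]
  by_cases hb : qPoch (z⁻¹ * q ^ n) q = 0
  · simp [hb]
  generalize qPoch (z⁻¹ * q ^ n) q = b at *
  generalize qPochFin z⁻¹ q n = c at *
  field_simp

theorem summable_STTerm (hq0 : q ≠ 0) (hq : ‖q‖ < 1) (h1 : ∀ k : ℕ, 1 - z * q ^ k ≠ 0)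
    (h2 : ∀ k : ℕ, 1 - z⁻¹ * q ^ k ≠ 0) : Summable (STTerm z q) := by
  obtain ⟨C1, hC1⟩ := exists_norm_qPochFin_le z hq
  obtain ⟨C2, hC2⟩ := exists_norm_qPochFin_le z⁻¹ hq
  obtain ⟨C3, hC3⟩ := exists_norm_qTail_le hq0 hq
  have hC1' : 0 ≤ C1 := (norm_nonneg _).trans (hC1 0)
  have hC2' : 0 ≤ C2 := (norm_nonneg _).trans (hC2 0)
  refine Summable.of_norm_bounded
    (g := fun n => ‖q‖ ^ n * (C1 * C2) * C3 * ‖(qPoch z q * qPoch z⁻¹ q)⁻¹‖)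
    ((((summable_geometric_of_lt_one (norm_nonneg q) hq).mul_right _).mul_right _).mul_right _)
    fun n => ?_
  rw [STTerm_eq hq h1 h2, pairFin, norm_mul, norm_mul, norm_mul, norm_mul, norm_pow]
  gcongr
  exacts [hC1 n, hC2 n, hC3 _]

theorem summable_baileyCoeff (hq0 : q ≠ 0) (hq : ‖q‖ < 1) :
    Summable fun r => ‖baileyCoeff q r‖ := by
  have h1 := summable_pow_quadratic_mul_zpow hq0 hq one_ne_zero (a := 6) (by norm_num) 1
  have h2 := summable_pow_quadratic_mul_zpow hq0 hq one_ne_zero (a := 6) (by norm_num) 7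
  simp only [one_zpow, mul_one, Nat.cast_ofNat] at h1 h2
  refine Summable.of_nonneg_of_le (fun _ => norm_nonneg _) (fun r => ?_)
    (h1.add (h2.mul_right ‖q ^ 2‖))
  rw [← norm_mul]
  refine le_trans (le_of_eq ?_) (norm_sub_le _ _)
  unfold baileyCoeff
  congr 1
  rw [← zpow_natCast, ← zpow_add₀ hq0, mul_sub, mul_one, ← zpow_add₀ hq0]
  congr 2 <;> push_cast <;> ring_nf

theorem exists_norm_baileyKernel_le (hz : z ≠ 0) (hq0 : q ≠ 0) (hq : ‖q‖ < 1) :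
    ∃ C, ∀ k, ‖baileyKernel z q k‖ ≤ C := by
  obtain ⟨C1, hC1⟩ := exists_norm_inv_one_sub_le hq0 hq hz
  obtain ⟨C2, hC2⟩ := exists_norm_inv_one_sub_le hq0 hq (inv_ne_zero hz)
  have hC1' : 0 ≤ C1 := (norm_nonneg _).trans (hC1 0)
  have hz' := norm_pos_iff.2 hz
  -- `z q^k / (1 - z q^k) = (1 - z q^k)⁻¹ - 1` is bounded as well
  refine ⟨‖z‖⁻¹ * ((C1 + 1) * C2), fun k => ?_⟩
  by_cases h : 1 - z * q ^ k = 0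
  · have hC2' : 0 ≤ C2 := (norm_nonneg _).trans (hC2 0)
    simp only [baileyKernel, h, zero_mul, div_zero, norm_zero]
    positivity
  have e : baileyKernel z q k
      = z⁻¹ * (((1 - z * q ^ k)⁻¹ - 1) * (1 - z⁻¹ * q ^ k)⁻¹) := by
    have : (1 - z * q ^ k)⁻¹ - 1 = z * q ^ k * (1 - z * q ^ k)⁻¹ := by
      field_simp; ring
    rw [this, baileyKernel, div_eq_mul_inv, mul_inv]
    field_simp
  rw [e, norm_mul, norm_mul, norm_inv]
  gcongr
  · exact (norm_sub_le _ _).trans (by rw [norm_one]; gcongr; exact hC1 k)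
  · exact hC2 k

theorem tendsto_natCast_sub_one_add (k : ℤ) :
    Tendsto (fun N : ℕ => (N : ℤ) - 1 + k) atTop atTop :=
  tendsto_atTop_add_const_right _ _ <| by
    simpa [sub_eq_add_neg] using
      tendsto_atTop_add_const_right atTop (-1 : ℤ) tendsto_natCast_atTop_atTop

/-- The bilateral form of `ST(z, q)`, by Bailey's lemma. -/
theorem qPoch_mul_ST (hz : z ≠ 0) (hq0 : q ≠ 0) (hq : ‖q‖ < 1)
    (h1 : ∀ k : ℕ, 1 - z * q ^ k ≠ 0) (h2 : ∀ k : ℕ, 1 - z⁻¹ * q ^ k ≠ 0) :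
    qPoch q q * ST z q = ∑' r : ℤ, baileyCoeff q r * baileyKernel z q (3 * r + 1) := by
  have hP1 := qPoch_ne_zero hq h1
  have hP2 := qPoch_ne_zero hq h2
  have hS := summable_STTerm hq0 hq h1 h2
  have hfin : ∀ N : ℕ, ∑' r : ℤ, baileyCoeff q r * (pairFin z q N *
      (qTail q (N - 1 - (3 * r + 1)) * qTail q (N - 1 + (3 * r + 1))) *
        baileyKernel z q (3 * r + 1))
      = qPoch q q * (qPoch z q * qPoch z⁻¹ q) * ∑ n ∈ range N, STTerm z q n := by
    intro N
    have hs : HasSum (fun r => ∑ n ∈ range N, q ^ n * pairFin z q n * baileyTerm q n r)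
        (∑ n ∈ range N, q ^ n * pairFin z q n * (qPoch q q * qTail q (2 * n - 1))) := by
      refine hasSum_sum fun n _ => HasSum.mul_left _ ?_
      rw [← tsum_baileyTerm hq0 hq]
      exact (summable_baileyTerm hq0 hq n).hasSum
    rw [mul_sum]
    refine Eq.trans (Eq.trans ?_ hs.tsum_eq) ?_
    · refine tsum_congr fun r => ?_
      rw [← sum_pairFin_mul_qTail hz hq0 hq h1 h2, mul_sum]
      refine sum_congr rfl fun n _ => ?_
      unfold baileyTerm; ring
    · refine sum_congr rfl fun n _ => ?_
      rw [STTerm_eq hq h1 h2]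
      generalize qPoch z⁻¹ q = b at *
      field_simp
  have hlim : Tendsto (fun N : ℕ => ∑' r : ℤ, baileyCoeff q r * (pairFin z q N *
      (qTail q (N - 1 - (3 * r + 1)) * qTail q (N - 1 + (3 * r + 1))) *
        baileyKernel z q (3 * r + 1))) atTop
      (𝓝 (∑' r : ℤ, baileyCoeff q r * (qPoch z q * qPoch z⁻¹ q * (1 * 1) *
        baileyKernel z q (3 * r + 1)))) := by
    obtain ⟨C1, hC1⟩ := exists_norm_qPochFin_le z hq
    obtain ⟨C2, hC2⟩ := exists_norm_qPochFin_le z⁻¹ hq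
    obtain ⟨C3, hC3⟩ := exists_norm_qTail_le hq0 hq
    obtain ⟨C4, hC4⟩ := exists_norm_baileyKernel_le hz hq0 hq
    have hC1' : 0 ≤ C1 := (norm_nonneg _).trans (hC1 0)
    have hC2' : 0 ≤ C2 := (norm_nonneg _).trans (hC2 0)
    have hC3' : 0 ≤ C3 := (norm_nonneg _).trans (hC3 0)
    refine tendsto_tsum_of_dominated_convergence
      ((summable_baileyCoeff hq0 hq).mul_right (C1 * C2 * (C3 * C3) * C4)) (fun r => ?_)
      (Eventually.of_forall fun N r => ?_)
    · have t1 := (tendsto_qTail hq).comp (tendsto_natCast_sub_one_add (-(3 * r + 1)))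
      have t2 := (tendsto_qTail hq).comp (tendsto_natCast_sub_one_add (3 * r + 1))
      exact ((((tendsto_qPochFin z hq).mul (tendsto_qPochFin z⁻¹ hq)).mul
        (t1.mul t2)).mul_const _).const_mul _
    · rw [pairFin, norm_mul, norm_mul, norm_mul, norm_mul, norm_mul]
      gcongr
      exacts [hC1 N, hC2 N, hC3 _, hC3 _, hC4 _]
  simp only [hfin] at hlim
  have h0 : STTerm z q 0 = 0 := by
    rw [STTerm_eq hq h1 h2, qTail_of_neg hq0 hq (by simp)]; simp
  have hST : ST z q = ∑' n, STTerm z q n := by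
    rw [hS.tsum_eq_zero_add, h0, zero_add, ST]
  have := tendsto_nhds_unique hlim (hS.hasSum.tendsto_sum_nat.const_mul _)
  rw [← hST] at this
  refine mul_left_cancel₀ (mul_ne_zero hP1 hP2) ?_
  rw [← tsum_mul_left, ← mul_assoc, mul_comm _ (qPoch q q), ← this]
  exact tsum_congr fun r => by ring

end

/-! ### Partial fractions of a quotient of theta products -/

/-- Lagrange interpolation of the monomial `X^m` evaluated at `1`. -/
theorem prod_inv_one_sub_eq_sum {ι : Type*} [DecidableEq ι] (s : Finset ι) (v : ι → ℂ)
    (hinj : Set.InjOn v s) (hv0 : ∀ i ∈ s, v i ≠ 0) (hv1 : ∀ i ∈ s, 1 - v i ≠ 0)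
    {m : ℕ} (hm : m < #s) :
    ∏ i ∈ s, (1 - v i)⁻¹ = ∑ i ∈ s, v i ^ m / (1 - v i) / v i ^ (#s - 1) *
      ∏ k ∈ s.erase i, (1 - v k / v i)⁻¹ := by
  have h := Lagrange.eq_interpolate (f := (Polynomial.X : Polynomial ℂ) ^ m) hinj
    (by rw [Polynomial.degree_X_pow]; exact_mod_cast hm)
  have h' := congrArg (Polynomial.eval 1) h
  rw [Lagrange.eval_interpolate_not_at_node _ (fun i hi => sub_ne_zero.1 (hv1 i hi)),
    Lagrange.eval_nodal] at h'
  simp only [Polynomial.eval_pow, Polynomial.eval_X, one_pow] at h'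
  rw [prod_inv_distrib]
  refine (eq_inv_of_mul_eq_one_right h'.symm).symm.trans ?_
  refine sum_congr rfl fun i hi => ?_
  have hw : Lagrange.nodalWeight s v i
      = (v i ^ (#s - 1))⁻¹ * ∏ k ∈ s.erase i, (1 - v k / v i)⁻¹ := by
    rw [Lagrange.nodalWeight, ← card_erase_of_mem hi, ← inv_pow, ← prod_const,
      ← prod_mul_distrib]
    refine prod_congr rfl fun k _ => ?_
    have := hv0 i hi
    rw [← mul_inv]; congr 1; field_simp
  rw [hw, div_eq_mul_inv, div_eq_mul_inv]
  ring

/-- The power `p^{i(i+1)/2}`, written as a product to avoid the division by `2`. -/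
def triPow (p : ℂ) (i : ℕ) : ℂ := ∏ k ∈ range i, p ^ (k + 1)

theorem triPow_ne_zero {p : ℂ} (hp0 : p ≠ 0) (i : ℕ) : triPow p i ≠ 0 :=
  prod_ne_zero_iff.2 fun _ _ => pow_ne_zero _ hp0

theorem triPow_pow_four (p : ℂ) (i : ℕ) : triPow p i ^ 4 = p ^ (2 * i * (i + 1)) := by
  induction i with
  | zero => simp [triPow]
  | succ i ih =>
    rw [triPow, prod_range_succ, mul_pow, ← triPow, ih, ← pow_mul, ← pow_add]
    congr 1; ring

/-- Factors with negative exponents, turned into a Pochhammer symbol of `p / u` by extracting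
`-u p^{-k}` from each. -/
theorem prod_one_sub_zpow_neg {p u : ℂ} (hp0 : p ≠ 0) (hu : u ≠ 0) (i : ℕ) :
    ∏ k ∈ range i, (1 - u * p ^ ((k : ℤ) - i))
      = qPochFin (p / u) p i * ((-u) ^ i / triPow p i) := by
  induction i with
  | zero => simp [qPochFin, triPow]
  | succ i ih =>
    have hT := triPow_ne_zero hp0 i
    have hpi := pow_ne_zero (i + 1) hp0
    have e : ∀ k : ℕ, (((k + 1 : ℕ) : ℤ) - (i + 1 : ℕ)) = k - i := fun k => by push_cast; ring
    rw [prod_range_succ']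
    simp only [e]
    rw [ih, qPochFin_succ, show triPow p (i + 1) = triPow p i * p ^ (i + 1) from
      prod_range_succ _ _, Nat.cast_zero, zero_sub, zpow_neg,
      zpow_natCast]
    field_simp
    ring

theorem prod_one_sub_zpow_shift {p u : ℂ} (hp0 : p ≠ 0) (hu : u ≠ 0) (i m : ℕ) :
    ∏ k ∈ range (i + m), (1 - u * p ^ ((k : ℤ) - i))
      = qPochFin u p m * qPochFin (p / u) p i * ((-u) ^ i / triPow p i) := by
  rw [prod_range_add, prod_one_sub_zpow_neg hp0 hu]
  simp only [Nat.cast_add, add_sub_cancel_left, zpow_natCast]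
  rw [← qPochFin]; ring

theorem prod_erase_one_sub_zpow_shift {p : ℂ} (hp0 : p ≠ 0) (i m : ℕ) :
    ∏ k ∈ (range (i + 1 + m)).erase i, (1 - p ^ ((k : ℤ) - i))
      = qPochFin p p i * qPochFin p p m * ((-1) ^ i / triPow p i) := by
  have h : ∏ k ∈ (range (i + 1 + m)).erase i, (1 - p ^ ((k : ℤ) - i))
      = ∏ k ∈ range (i + 1 + m), if k = i then 1 else (1 - p ^ ((k : ℤ) - i)) := by
    rw [← prod_erase (range (i + 1 + m)) (a := i) (by simp)]
    exact prod_congr rfl fun k hk => (if_neg (ne_of_mem_erase hk)).symm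
  have h1 : (∏ k ∈ range i, if k = i then 1 else (1 - p ^ ((k : ℤ) - i)))
      = ∏ k ∈ range i, (1 - 1 * p ^ ((k : ℤ) - i)) :=
    prod_congr rfl fun k hk => by rw [if_neg (mem_range.1 hk).ne, one_mul]
  have h2 : (∏ k ∈ range m, if i + 1 + k = i then 1 else (1 - p ^ (((i + 1 + k : ℕ) : ℤ) - i)))
      = qPochFin p p m := by
    refine prod_congr rfl fun k _ => ?_
    rw [if_neg (by omega), ← pow_succ', ← zpow_natCast]
    congr 2; push_cast; ring
  rw [h, prod_range_add, prod_range_succ, h1, h2, if_pos rfl,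
    prod_one_sub_zpow_neg hp0 one_ne_zero, div_one]
  ring

section
variable {p : ℂ} {b : Fin 4 → ℂ}

/-- The products, normalised to converge as `N → ∞`, that multiply the term of index `n` at the
pole `b_j` in the partial fraction expansion with nodes `b_l p^k`, `-N ≤ k ≤ N`. -/
def nodeWeight (p : ℂ) (b : Fin 4 → ℂ) (j : Fin 4) (N : ℕ) (n : ℤ) : ℂ :=
  (∏ l ∈ univ.erase j, (qPochFin (b l / b j) p ((N - n).toNat + 1)
      * qPochFin (p / (b l / b j)) p (N + n).toNat)⁻¹)
    * (qPochFin p p (N + n).toNat * qPochFin p p (N - n).toNat)⁻¹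

/-- The product over all nodes other than `b_j p^{i-N}` in the Lagrange coefficient. -/
theorem prod_nodes_erase (hp0 : p ≠ 0) (hb : ∀ j, b j ≠ 0) (j : Fin 4) (N : ℕ) (i : ℕ)
    (hi : i < 2 * N + 1) :
    ∏ k ∈ ((univ : Finset (Fin 4)) ×ˢ range (2 * N + 1)).erase (j, i),
        (1 - b k.1 * p ^ ((k.2 : ℤ) - N) / (b j * p ^ ((i : ℤ) - N)))⁻¹
      = nodeWeight p b j N ((i : ℤ) - N) * (p ^ (2 * i * (i + 1)) * (b j ^ 4 / ∏ l, b l) ^ i) := by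
  have hs : ((univ : Finset (Fin 4)) ×ˢ range (2 * N + 1)).erase (j, i)
      = (univ.erase j ×ˢ range (2 * N + 1)) ∪ ({j} ×ˢ (range (2 * N + 1)).erase i) := by
    ext ⟨l, k⟩
    by_cases h : l = j
    · simp [h]
    · simp [h, Ne.symm h]
  have hd : Disjoint (univ.erase j ×ˢ range (2 * N + 1))
      (({j} : Finset (Fin 4)) ×ˢ (range (2 * N + 1)).erase i) := by
    rw [disjoint_left]
    rintro ⟨l, k⟩ h1 h2
    simp only [mem_product, mem_erase, mem_singleton] at h1 h2
    exact h1.1.1 h2.1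
  have e : ∀ (l : Fin 4) (k : ℕ), b l * p ^ ((k : ℤ) - N) / (b j * p ^ ((i : ℤ) - N))
      = b l / b j * p ^ ((k : ℤ) - i) := by
    intro l k
    rw [mul_div_mul_comm, ← zpow_sub₀ hp0]
    congr 2; ring
  have e1 : ((N : ℤ) - ((i : ℤ) - N)).toNat = 2 * N - i := by omega
  have e2 : ((N : ℤ) + ((i : ℤ) - N)).toNat = i := by omega
  rw [hs, prod_union hd, prod_product, prod_product, prod_singleton]
  simp only [e, div_self (hb j), one_mul, prod_inv_distrib]
  have h1 : ∀ l, ∏ k ∈ range (2 * N + 1), (1 - b l / b j * p ^ ((k : ℤ) - i))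
      = qPochFin (b l / b j) p (2 * N - i + 1) * qPochFin (p / (b l / b j)) p i
        * ((-(b l / b j)) ^ i / triPow p i) := fun l => by
    rw [← prod_one_sub_zpow_shift hp0 (div_ne_zero (hb l) (hb j))]
    congr 2; omega
  have h2 : ∏ k ∈ (range (2 * N + 1)).erase i, (1 - p ^ ((k : ℤ) - i))
      = qPochFin p p i * qPochFin p p (2 * N - i) * ((-1) ^ i / triPow p i) := by
    rw [← prod_erase_one_sub_zpow_shift hp0]
    congr 3; omega
  have h3 : (∏ l ∈ univ.erase j, ((-(b l / b j)) ^ i / triPow p i)) * ((-1) ^ i / triPow p i)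
      = (p ^ (2 * i * (i + 1)) * (b j ^ 4 / ∏ l, b l) ^ i)⁻¹ := by
    have : ((-1 : ℂ) ^ i / triPow p i) = (-(b j / b j)) ^ i / triPow p i := by
      rw [div_self (hb j)]
    rw [this, mul_comm, mul_prod_erase univ (fun l => (-(b l / b j)) ^ i / triPow p i) (mem_univ j),
      prod_div_distrib, prod_const, card_univ, Fintype.card_fin, triPow_pow_four, prod_pow]
    have : ∏ l, -(b l / b j) = (∏ l, b l) / b j ^ 4 := by
      simp only [Fin.prod_univ_four]
      have := hb j
      field_simp
    rw [this, mul_inv, div_eq_mul_inv, mul_comm, ← inv_pow (b j ^ 4 / _), inv_div]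
  simp only [h1]
  rw [h2, prod_mul_distrib, ← mul_inv, mul_mul_mul_comm, h3, mul_inv, inv_inv]
  unfold nodeWeight
  rw [e1, e2, prod_inv_distrib, mul_inv]

theorem node_power_identity {β B : ℂ} (hp0 : p ≠ 0) (hβ : β ≠ 0) (hB : B ≠ 0) (d : ℤ) (N i : ℕ) :
    (β * p ^ ((i : ℤ) - N)) ^ (d - 4 * N) * (p ^ (2 * i * (i + 1)) * (β ^ 4 / B) ^ i)
        * (B ^ N / p ^ (2 * N * (N + 1)))
      = β ^ d * (p ^ (2 * ((i : ℤ) - N) * ((i : ℤ) - N + 1))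
        * (p ^ d * β ^ 4 / B) ^ ((i : ℤ) - N)) := by
  have h : p ^ d * β ^ 4 / B = p ^ d * (β ^ (4 : ℤ) * B ^ (-1 : ℤ)) := by
    rw [zpow_neg_one, ← zpow_natCast]; push_cast; ring
  have h' : β ^ 4 / B = β ^ (4 : ℤ) * B ^ (-1 : ℤ) := by
    rw [zpow_neg_one, ← zpow_natCast]; push_cast; ring
  rw [h, h', div_eq_mul_inv]
  simp only [← zpow_natCast, mul_zpow, ← zpow_mul, ← zpow_neg]
  have key : ∀ a1 a2 a3 a4 a5 a6 a7 c1 c2 c3 c4 c5 : ℤ, a1 + a4 = c1 + c4 → a2 + a3 + a7 = c2 + c3 →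
      a5 + a6 = c5 → β ^ a1 * p ^ a2 * (p ^ a3 * (β ^ a4 * B ^ a5)) * (B ^ a6 * p ^ a7)
        = β ^ c1 * (p ^ c2 * (p ^ c3 * (β ^ c4 * B ^ c5))) := by
    intro a1 a2 a3 a4 a5 a6 a7 c1 c2 c3 c4 c5 k1 k2 k3
    calc _ = β ^ (a1 + a4) * p ^ (a2 + a3 + a7) * B ^ (a5 + a6) := by
          simp only [zpow_add₀ hp0, zpow_add₀ hβ, zpow_add₀ hB]; ring
      _ = _ := by
          rw [k1, k2, k3]; simp only [zpow_add₀ hp0, zpow_add₀ hβ]; ring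
  apply key <;> push_cast <;> ring

/-- The Lagrange interpolation formula at the nodes `b_j p^n`, `|n| ≤ N`, for the monomial of degree
`d + 4N + 3`. This degree cancels the factor `p^{4nN}` of the coefficients. -/
theorem partialFraction_finite (hp0 : p ≠ 0) (hp : ‖p‖ < 1) (hb : ∀ j, b j ≠ 0)
    (h1 : ∀ j (n : ℤ), 1 - b j * p ^ n ≠ 0)
    (h2 : ∀ j l, l ≠ j → ∀ n : ℤ, 1 - b l / b j * p ^ n ≠ 0) (d : ℤ) {N : ℕ} (hN : |d| ≤ N) :
    ∏ j, (qPochFin (b j) p (N + 1) * qPochFin (p / b j) p N)⁻¹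
      = ∑ j, b j ^ d * ∑ n ∈ Icc (-N : ℤ) N,
          SigmaTerm (b j) (p ^ d * b j ^ 4 / ∏ l, b l) p n * nodeWeight p b j N n := by
  set v : Fin 4 × ℕ → ℂ := fun k => b k.1 * p ^ ((k.2 : ℤ) - N) with hv
  set s := (univ : Finset (Fin 4)) ×ˢ range (2 * N + 1) with hs
  have hcard : #s = 8 * N + 4 := by
    rw [hs, card_product, card_range, card_univ, Fintype.card_fin]; ring
  have hB : ∏ l, b l ≠ 0 := prod_ne_zero_iff.2 fun l _ => hb l
  have hv0 : ∀ k, v k ≠ 0 := fun k => mul_ne_zero (hb _) (zpow_ne_zero _ hp0)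
  have hinj : Set.InjOn v s := by
    rintro ⟨j, i⟩ - ⟨l, k⟩ - h
    have e : b l / b j * p ^ ((k : ℤ) - i) = 1 := by
      have : v (l, k) / v (j, i) = 1 := by rw [← h, div_self (hv0 _)]
      rw [← this, hv, mul_div_mul_comm, ← zpow_sub₀ hp0]
      congr 2; ring
    by_cases hlj : l = j
    · subst hlj
      rw [div_self (hb l), one_mul] at e
      have : (k : ℤ) - i = 0 := by
        by_contra hne; exact zpow_ne_one_of_norm_lt_one hp hne e
      rw [Prod.mk.injEq]; exact ⟨rfl, by omega⟩
    · exact absurd (sub_eq_zero.2 e.symm) (h2 j l hlj _)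
  have hd := abs_le.1 hN
  have hm : (d + 4 * N + 3).toNat < #s := by rw [hcard]; omega
  have key := prod_inv_one_sub_eq_sum s v hinj (fun k _ => hv0 k) (fun k _ => h1 _ _) hm
  set K : ℂ := (∏ l, b l) ^ N / p ^ (2 * N * (N + 1)) with hK
  have hK0 : K ≠ 0 := div_ne_zero (pow_ne_zero _ hB) (pow_ne_zero _ hp0)
  have hlhs : ∏ k ∈ s, (1 - v k)⁻¹
      = (∏ j, (qPochFin (b j) p (N + 1) * qPochFin (p / b j) p N)⁻¹) * K⁻¹ := by
    have hr : 2 * N + 1 = N + (N + 1) := by ring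
    have h3 : ∏ j, ((-b j) ^ N / triPow p N) = K := by
      rw [prod_div_distrib, prod_const, card_univ, Fintype.card_fin, triPow_pow_four, prod_pow, hK]
      congr 2
      simp only [Fin.prod_univ_four]; ring
    rw [hs, prod_product, ← h3]
    simp only [prod_inv_distrib, hr, hv]
    rw [← mul_inv, ← prod_mul_distrib]
    simp only [prod_one_sub_zpow_shift hp0 (hb _)]
  rw [hlhs] at key
  have key' := (eq_mul_inv_iff_mul_eq₀ hK0).1 key.symm
  rw [← key', hs, sum_product, sum_mul]
  refine sum_congr rfl fun j _ => ?_
  have hre : ∀ f : ℤ → ℂ, ∑ n ∈ Icc (-N : ℤ) N, f n = ∑ i ∈ range (2 * N + 1), f ((i : ℤ) - N) := by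
    intro f
    symm
    refine sum_nbij' (fun i => (i : ℤ) - N) (fun n => (n + N).toNat) ?_ ?_ ?_ ?_ ?_
    · intro i hi; rw [mem_range] at hi; rw [mem_Icc]; omega
    · intro n hn; rw [mem_Icc] at hn; rw [mem_range]; omega
    · intro i hi; omega
    · intro n hn; rw [mem_Icc] at hn; omega
    · intro i hi; rfl
  rw [hre, mul_sum, sum_mul]
  refine sum_congr rfl fun i hi => ?_
  rw [prod_nodes_erase hp0 hb j N i (mem_range.1 hi), card_product, card_range, card_univ,
    Fintype.card_fin]
  have hpow : v (j, i) ^ (d + 4 * N + 3).toNat / v (j, i) ^ (4 * (2 * N + 1) - 1)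
      = v (j, i) ^ (d - 4 * N) := by
    rw [← zpow_natCast, ← zpow_natCast, ← zpow_sub₀ (hv0 _)]
    congr 1; omega
  have hid := node_power_identity hp0 (hb j) hB d N i
  rw [div_right_comm, hpow]
  unfold SigmaTerm
  rw [← hK] at hid
  simp only [hv] at *
  linear_combination (nodeWeight p b j N ((i : ℤ) - N) / (1 - b j * p ^ ((i : ℤ) - N))) * hid

/-- The partial fraction expansion of `1 / ([b₁; p] [b₂; p] [b₃; p] [b₄; p])`. The exponent `d` is
arbitrary because an interpolation node may be raised to any power below the number of nodes. -/
theorem partialFraction (hp0 : p ≠ 0) (hp : ‖p‖ < 1) (hb : ∀ j, b j ≠ 0)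
    (h1 : ∀ j (n : ℤ), 1 - b j * p ^ n ≠ 0)
    (h2 : ∀ j l, l ≠ j → ∀ n : ℤ, 1 - b l / b j * p ^ n ≠ 0) (d : ℤ) :
    qPoch p p ^ 2 * ∏ j, (jacProd (b j) p)⁻¹
      = ∑ j, b j ^ d * (∏ l ∈ univ.erase j, (jacProd (b l / b j) p)⁻¹)
          * SigmaSeries (b j) (p ^ d * b j ^ 4 / ∏ l, b l) p := by
  have hB : ∏ l, b l ≠ 0 := prod_ne_zero_iff.2 fun l _ => hb l
  have hP := qPoch_self_ne_zero hp
  have hnz : ∀ x : ℂ, (∀ n : ℤ, 1 - x * p ^ n ≠ 0) → ∀ k : ℕ, 1 - x * p ^ k ≠ 0 := fun x h k => by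
    simpa using h k
  have hnz' : ∀ x : ℂ, x ≠ 0 → (∀ n : ℤ, 1 - x * p ^ n ≠ 0) → ∀ k : ℕ, 1 - p / x * p ^ k ≠ 0 := by
    intro x hx h k hk
    apply h (-(k + 1 : ℕ))
    rw [zpow_neg, zpow_natCast]
    have := pow_ne_zero (k + 1) hp0
    field_simp at hk ⊢
    rw [pow_succ] at *
    linear_combination -hk
  have hself := one_sub_mul_pow_self_ne_zero hp
  have hL : Tendsto (fun N : ℕ => ∏ j, (qPochFin (b j) p (N + 1) * qPochFin (p / b j) p N)⁻¹)
      atTop (𝓝 (∏ j, (jacProd (b j) p)⁻¹)) := by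
    refine tendsto_finsetProd _ fun j _ => Tendsto.inv₀ (Tendsto.mul ?_ ?_) ?_
    · exact (tendsto_qPochFin _ hp).comp (tendsto_add_atTop_nat 1)
    · exact tendsto_qPochFin _ hp
    · exact mul_ne_zero (qPoch_ne_zero hp (hnz _ (h1 j)))
        (qPoch_ne_zero hp (hnz' _ (hb j) (h1 j)))
  have hw : ∀ j (n : ℤ), Tendsto (fun N : ℕ => nodeWeight p b j N n) atTop
      (𝓝 ((∏ l ∈ univ.erase j, (jacProd (b l / b j) p)⁻¹) * (qPoch p p * qPoch p p)⁻¹)) := by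
    intro j n
    have ta : Tendsto (fun N : ℕ => (N + n).toNat) atTop atTop :=
      tendsto_atTop_atTop.2 fun M => ⟨(M - n).toNat, fun N hN => by omega⟩
    have tb : Tendsto (fun N : ℕ => (N - n).toNat) atTop atTop :=
      tendsto_atTop_atTop.2 fun M => ⟨(M + n).toNat, fun N hN => by omega⟩
    refine Tendsto.mul (tendsto_finsetProd _ fun l hl => Tendsto.inv₀ (Tendsto.mul ?_ ?_) ?_)
      (Tendsto.inv₀ (Tendsto.mul ?_ ?_) (mul_ne_zero hP hP))
    · exact (tendsto_qPochFin _ hp).comp ((tendsto_add_atTop_nat 1).comp tb)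
    · exact (tendsto_qPochFin _ hp).comp ta
    · have := h2 j l (ne_of_mem_erase hl)
      exact mul_ne_zero (qPoch_ne_zero hp (hnz _ this))
        (qPoch_ne_zero hp (hnz' _ (div_ne_zero (hb l) (hb j)) this))
    · exact (tendsto_qPochFin _ hp).comp ta
    · exact (tendsto_qPochFin _ hp).comp tb
  have hbound : ∀ j, ∃ C, ∀ (N : ℕ) (n : ℤ), ‖nodeWeight p b j N n‖ ≤ C := by
    intro j
    have hl : ∀ l, ∃ C, l ≠ j → ∀ m k : ℕ,
        ‖(qPochFin (b l / b j) p m * qPochFin (p / (b l / b j)) p k)⁻¹‖ ≤ C := by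
      intro l
      by_cases hlj : l = j
      · exact ⟨0, fun h => absurd hlj h⟩
      have := h2 j l hlj
      obtain ⟨C1, hC1⟩ := exists_norm_inv_qPochFin_le hp (hnz _ this)
      obtain ⟨C2, hC2⟩ := exists_norm_inv_qPochFin_le hp
        (hnz' _ (div_ne_zero (hb l) (hb j)) this)
      refine ⟨C1 * C2, fun _ m k => ?_⟩
      rw [mul_inv, norm_mul]
      exact mul_le_mul (hC1 m) (hC2 k) (norm_nonneg _) ((norm_nonneg _).trans (hC1 0))
    choose C hC using hl
    obtain ⟨D, hD⟩ := exists_norm_inv_qPochFin_le hp hself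
    refine ⟨(∏ l ∈ univ.erase j, C l) * (D * D), fun N n => ?_⟩
    rw [nodeWeight, norm_mul, norm_prod, mul_inv, norm_mul]
    refine mul_le_mul (prod_le_prod (fun _ _ => norm_nonneg _)
      fun l hl => hC l (ne_of_mem_erase hl) _ _)
      (mul_le_mul (hD _) (hD _) (norm_nonneg _) ((norm_nonneg _).trans (hD 0))) (by positivity)
      (prod_nonneg fun l hl => (norm_nonneg _).trans (hC l (ne_of_mem_erase hl) 0 0))
  have hR : ∀ j, Tendsto (fun N : ℕ => ∑ n ∈ Icc (-N : ℤ) N,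
      SigmaTerm (b j) (p ^ d * b j ^ 4 / ∏ l, b l) p n * nodeWeight p b j N n) atTop
      (𝓝 (∑' n, SigmaTerm (b j) (p ^ d * b j ^ 4 / ∏ l, b l) p n *
        ((∏ l ∈ univ.erase j, (jacProd (b l / b j) p)⁻¹) * (qPoch p p * qPoch p p)⁻¹))) := by
    intro j
    obtain ⟨C, hC⟩ := hbound j
    have hC0 : 0 ≤ C := (norm_nonneg _).trans (hC 0 0)
    have hsum := summable_norm_SigmaTerm hp0 hp (w := p ^ d * b j ^ 4 / ∏ l, b l)
      (div_ne_zero (mul_ne_zero (zpow_ne_zero _ hp0) (pow_ne_zero _ (hb j))) hB) (hb j)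
    have := tendsto_tsum_of_dominated_convergence (𝓕 := atTop)
      (f := fun (N : ℕ) (n : ℤ) => if n ∈ Icc (-N : ℤ) N then
        SigmaTerm (b j) (p ^ d * b j ^ 4 / ∏ l, b l) p n * nodeWeight p b j N n else 0)
      (g := fun n => SigmaTerm (b j) (p ^ d * b j ^ 4 / ∏ l, b l) p n *
        ((∏ l ∈ univ.erase j, (jacProd (b l / b j) p)⁻¹) * (qPoch p p * qPoch p p)⁻¹))
      (hsum.mul_right C) (fun n => ?_) (Eventually.of_forall fun N n => ?_)
    · refine this.congr fun N => ?_
      rw [tsum_eq_sum (s := Icc (-N : ℤ) N) fun n hn => if_neg hn]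
      exact sum_congr rfl fun n hn => if_pos hn
    · refine ((hw j n).const_mul _).congr' ?_
      filter_upwards [eventually_ge_atTop n.natAbs] with N hN
      rw [if_pos (by rw [mem_Icc]; omega)]
    · split_ifs
      · rw [norm_mul]; gcongr; exact hC N n
      · rw [norm_zero]; positivity
  have hlim := tendsto_finsetSum (univ : Finset (Fin 4)) fun j _ => (hR j).const_mul (b j ^ d)
  have heq := tendsto_nhds_unique (hL.congr' ?_) hlim
  · rw [heq, mul_sum]
    refine sum_congr rfl fun j _ => ?_
    rw [tsum_mul_right, SigmaSeries]
    field_simp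
  · filter_upwards [eventually_ge_atTop d.natAbs] with N hN
    exact partialFraction_finite hp0 hp hb h1 h2 d (by rw [abs_le]; omega)

end

/-! ### Jacobi's triple product -/

theorem int_choose_add (k : ℤ) (n : ℤ) :
    (k + n) * (k + n - 1) / 2 = k * (k - 1) / 2 + n * (n - 1) / 2 + k * n := by
  have h1 := Int.ediv_mul_cancel (Int.even_mul_pred_self k).two_dvd
  have h2 := Int.ediv_mul_cancel (Int.even_mul_pred_self n).two_dvd
  have h3 := Int.ediv_mul_cancel (Int.even_mul_pred_self (k + n)).two_dvd
  have : (k + n) * (k + n - 1) = k * (k - 1) + n * (n - 1) + k * n * 2 := by ring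
  omega

/-- The term `p^{k(k-1)/2} (-z)^k` of the theta series. -/
def thetaTerm (p z : ℂ) (k : ℤ) : ℂ := p ^ (k * (k - 1) / 2) * (-z) ^ k

section
variable {p z : ℂ}

theorem summable_norm_thetaTerm (hp0 : p ≠ 0) (hp : ‖p‖ < 1) (hz : z ≠ 0) :
    Summable fun k => ‖thetaTerm p z k‖ :=
  summable_pow_choose_mul_zpow hp0 hp (neg_ne_zero.2 hz)

theorem thetaTerm_add_one (hp0 : p ≠ 0) (hz : z ≠ 0) (k : ℤ) :
    thetaTerm p z (k + 1) = -z * thetaTerm p (z * p) k := by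
  have hz' := neg_ne_zero.2 hz
  unfold thetaTerm
  rw [int_choose_add, ← neg_mul, mul_zpow, zpow_add₀ hp0, zpow_add₀ hp0, zpow_add_one₀ hz']
  simp
  ring

/-- The `q`-binomial theorem, with reciprocal `q`-factorials expressed by `qTail`. -/
theorem tsum_thetaTerm_mul_qTail (hp0 : p ≠ 0) (hp : ‖p‖ < 1) (hz : z ≠ 0) (M : ℕ) :
    ∑' k, thetaTerm p z k * (qTail p k * qTail p (M - k))
      = qPoch p p * qTail p M * qPochFin z p M := by
  have hsum : ∀ (w : ℂ) (K : ℕ),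
      Summable fun k => thetaTerm p w k * (qTail p k * qTail p (K - k)) := by
    intro w K
    refine summable_of_ne_finset_zero (s := Icc (0 : ℤ) K) fun k hk => ?_
    rw [mem_Icc, not_and_or] at hk
    rcases lt_or_ge k 0 with h | h
    · rw [qTail_of_neg hp0 hp h]; ring
    · rw [qTail_of_neg hp0 hp (m := K - k) (by omega)]; ring
  induction M generalizing z with
  | zero =>
    rw [tsum_eq_single 0]
    · simp [thetaTerm, qPochFin, qTail_zero]
    · intro k hk
      rcases lt_or_ge k 0 with h | h
      · rw [qTail_of_neg hp0 hp h]; ring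
      · rw [qTail_of_neg hp0 hp (m := _ - k) (by push_cast; omega)]; ring
  | succ M ih =>
    have hM : 1 - p ^ ((M : ℤ) + 1) ≠ 0 :=
      sub_ne_zero.2 (zpow_ne_one_of_norm_lt_one hp (by omega)).symm
    have s := qTail_sub_one hp0 hp
    have hz' := mul_ne_zero hz hp0
    have hshift : ∑' k, thetaTerm p z k * (qTail p (k - 1) * qTail p (M + 1 - k))
        = -z * ∑' k, thetaTerm p (z * p) k * (qTail p k * qTail p (M - k)) := by
      rw [← (Equiv.addRight (1 : ℤ)).tsum_eq, ← tsum_mul_left]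
      refine tsum_congr fun k => ?_
      rw [Equiv.coe_addRight, thetaTerm_add_one hp0 hz, add_sub_cancel_right,
        add_sub_add_right_eq_sub]
      ring
    have hS2 : Summable fun k => thetaTerm p z k * (qTail p (k - 1) * qTail p (M + 1 - k)) := by
      rw [← (Equiv.addRight (1 : ℤ)).summable_iff]
      refine ((hsum (z * p) M).mul_left (-z)).congr fun k => ?_
      rw [Function.comp_apply, Equiv.coe_addRight, thetaTerm_add_one hp0 hz, add_sub_cancel_right,
        add_sub_add_right_eq_sub]
      ring
    have hrec : ∀ k : ℤ, (1 - p ^ ((M : ℤ) + 1)) *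
        (thetaTerm p z k * (qTail p k * qTail p ((M + 1 : ℕ) - k)))
        = thetaTerm p (z * p) k * (qTail p k * qTail p (M - k))
          + thetaTerm p z k * (qTail p (k - 1) * qTail p (M + 1 - k)) := by
      intro k
      have e1 : qTail p (M - k) = (1 - p ^ ((M : ℤ) + 1 - k)) * qTail p (M + 1 - k) := by
        rw [← s]; congr 1; ring
      have e2 : p ^ k * p ^ ((M : ℤ) + 1 - k) = p ^ ((M : ℤ) + 1) := by
        rw [← zpow_add₀ hp0]; congr 1; ring
      rw [e1, s]
      push_cast
      unfold thetaTerm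
      rw [← neg_mul, mul_zpow]
      linear_combination (p ^ (k * (k - 1) / 2) * (-z) ^ k * qTail p k * qTail p (M + 1 - k)) * e2
    refine mul_left_cancel₀ hM ?_
    rw [← tsum_mul_left, tsum_congr hrec, (hsum _ _).tsum_add hS2, hshift, ih hz',
      qPochFin_succ']
    have := s (M + 1)
    rw [add_sub_cancel_right] at this
    push_cast
    rw [this]; ring

/-- The finite form of the triple product identity. -/
theorem tsum_thetaTerm_mul_qTail_symm (hp0 : p ≠ 0) (hp : ‖p‖ < 1) (hz : z ≠ 0) (N : ℕ) :
    ∑' k, thetaTerm p z k * (qTail p (N + k) * qTail p (N - k))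
      = qPoch p p * qTail p (2 * N) * (qPochFin z p N * qPochFin (p / z) p N) := by
  have hz' := neg_ne_zero.2 hz
  have hT := triPow_ne_zero hp0 N
  have htri : p ^ ((N : ℤ) * (N - 1) / 2) * p ^ N = triPow p N := by
    induction N with
    | zero => simp [triPow]
    | succ N ih =>
      rw [triPow, prod_range_succ, ← triPow, ← ih (triPow_ne_zero hp0 N)]
      push_cast
      rw [int_choose_add, zpow_add₀ hp0, zpow_add₀ hp0]
      simp
  have h := tsum_thetaTerm_mul_qTail hp0 hp (mul_ne_zero hz (zpow_ne_zero (-N) hp0)) (N + N)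
  have hF : qPochFin (z * p ^ (-N : ℤ)) p (N + N)
      = qPochFin z p N * qPochFin (p / z) p N * ((-z) ^ N / triPow p N) := by
    rw [← prod_one_sub_zpow_shift hp0 hz]
    refine prod_congr rfl fun k _ => ?_
    rw [mul_assoc, ← zpow_natCast, ← zpow_add₀ hp0]; congr 3; ring
  rw [hF, ← (Equiv.addRight (N : ℤ)).tsum_eq] at h
  have hc : (-z) ^ N / triPow p N ≠ 0 := div_ne_zero (pow_ne_zero _ hz') hT
  refine mul_right_cancel₀ hc ?_
  rw [← tsum_mul_right]
  refine Eq.trans (tsum_congr fun k => ?_) (h.trans ?_)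
  · have e1 : (((N + N : ℕ) : ℤ) - (k + N)) = N - k := by push_cast; ring
    have e2 : thetaTerm p (z * p ^ (-N : ℤ)) (k + N)
        = thetaTerm p z k * ((-z) ^ N / triPow p N) := by
      unfold thetaTerm
      rw [← htri, int_choose_add, ← neg_mul, mul_zpow, ← zpow_mul, zpow_add₀ hz', zpow_natCast,
        zpow_add₀ hp0, zpow_add₀ hp0, mul_add, zpow_add₀ hp0, ← zpow_natCast p]
      have a1 : p ^ (k * (N : ℤ)) * p ^ (-(N : ℤ) * k) = 1 := by
        rw [← zpow_add₀ hp0]; ring_nf; exact zpow_zero p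
      have a2 : p ^ ((N : ℤ) * (N - 1) / 2) * p ^ (-(N : ℤ) * N)
          * (p ^ ((N : ℤ) * (N - 1) / 2) * p ^ (N : ℤ)) = 1 := by
        have := Int.ediv_mul_cancel (Int.even_mul_pred_self (N : ℤ)).two_dvd
        rw [← zpow_add₀ hp0, ← zpow_add₀ hp0, ← zpow_add₀ hp0, ← zpow_zero p]
        congr 1
        linear_combination this
      rw [eq_comm, mul_div_assoc', div_eq_iff (mul_ne_zero (zpow_ne_zero _ hp0)
        (zpow_ne_zero _ hp0))]
      linear_combination (-p ^ (k * (k - 1) / 2) * (-z) ^ k * (-z) ^ N) * a1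
        - (p ^ (k * (k - 1) / 2) * (-z) ^ k * (-z) ^ N
          * (p ^ (k * (N : ℤ)) * p ^ (-(N : ℤ) * k))) * a2
    rw [Equiv.coe_addRight, e1, e2, add_comm (N : ℤ) k]; ring
  · push_cast; ring_nf

/-- **Jacobi's triple product identity**. -/
theorem tsum_thetaTerm (hp0 : p ≠ 0) (hp : ‖p‖ < 1) (hz : z ≠ 0) :
    ∑' k, thetaTerm p z k = qPoch p p * jacProd z p := by
  obtain ⟨C, hC⟩ := exists_norm_qTail_le hp0 hp
  have hC0 : 0 ≤ C := (norm_nonneg _).trans (hC 0)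
  have ht := tendsto_natCast_atTop_atTop (R := ℤ)
  have hlim : Tendsto (fun N : ℕ => ∑' k, thetaTerm p z k * (qTail p (N + k) * qTail p (N - k)))
      atTop (𝓝 (∑' k, thetaTerm p z k * (1 * 1))) := by
    refine tendsto_tsum_of_dominated_convergence
      ((summable_norm_thetaTerm hp0 hp hz).mul_right (C * C)) (fun k => ?_)
      (Eventually.of_forall fun N k => ?_)
    · exact (((tendsto_qTail hp).comp (tendsto_atTop_add_const_right _ k ht)).mul
        ((tendsto_qTail hp).comp (tendsto_atTop_add_const_right _ (-k) ht))).const_mul _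
    · rw [norm_mul, norm_mul]
      gcongr
      exacts [hC _, hC _]
  simp only [tsum_thetaTerm_mul_qTail_symm hp0 hp hz, mul_one] at hlim
  refine tendsto_nhds_unique hlim ?_
  have h2 := (tendsto_qTail hp).comp (ht.const_mul_atTop' (two_pos : (0 : ℤ) < 2))
  have := (h2.const_mul (qPoch p p)).mul ((tendsto_qPochFin z hp).mul (tendsto_qPochFin (p / z) hp))
  rwa [mul_one] at this

theorem jacProd_inv (hp : ‖p‖ < 1) (hz : z ≠ 0) : jacProd z⁻¹ p = -z⁻¹ * jacProd z p := by
  unfold jacProd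
  rw [qPoch_eq_mul z⁻¹ hp, qPoch_eq_mul z hp, div_inv_eq_mul, mul_comm p z, mul_comm z⁻¹ p,
    ← div_eq_mul_inv]
  field_simp
  ring

theorem jacProd_div (hp0 : p ≠ 0) : jacProd (p / z) p = jacProd z p := by
  unfold jacProd
  rw [div_div_cancel₀ hp0, mul_comm]

/-! ### Weierstrass's three-term relation -/

/-- Half of the rank two splitting of `θ(xy) θ(x/y)`: the series `∑ p^{n²} x^{2n}`. -/
def thetaEven (p x : ℂ) : ℂ := ∑' n : ℤ, p ^ n ^ 2 * x ^ (2 * n)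

/-- The other half of the splitting: the series `∑ p^{n²-n} x^{2n-1}`. -/
def thetaOdd (p x : ℂ) : ℂ := ∑' n : ℤ, p ^ (n ^ 2 - n) * x ^ (2 * n - 1)

/-- The pairs `(m, n)` of integers, parametrised according to the parity of `m + n`. -/
def paritySplit : (ℤ × ℤ) ⊕ (ℤ × ℤ) → ℤ × ℤ :=
  Sum.elim (fun c => (c.1 + c.2, c.1 - c.2)) fun c => (c.1 + c.2, c.1 - c.2 + 1)

theorem paritySplit_bijective : Function.Bijective paritySplit := by
  constructor
  · rintro (⟨a, b⟩ | ⟨a, b⟩) (⟨c, d⟩ | ⟨c, d⟩) h <;>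
      simp only [paritySplit, Sum.elim_inl, Sum.elim_inr, Prod.mk.injEq, Sum.inl.injEq,
        Sum.inr.injEq, reduceCtorEq] at h ⊢ <;> omega
  · rintro ⟨m, n⟩
    by_cases h : (m + n) % 2 = 0
    · refine ⟨.inl ((m + n) / 2, (m - n) / 2), ?_⟩
      simp only [paritySplit, Sum.elim_inl, Prod.mk.injEq]; omega
    · refine ⟨.inr ((m + n - 1) / 2, (m - n + 1) / 2), ?_⟩
      simp only [paritySplit, Sum.elim_inr, Prod.mk.injEq]; omega

/-- Multiplying the two theta series and summing over the two parity classes of index pairs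
separates the variables. -/
theorem theta_mul_theta (hp0 : p ≠ 0) (hp : ‖p‖ < 1) {x y : ℂ} (hx : x ≠ 0) (hy : y ≠ 0) :
    qPoch p p ^ 2 * (x⁻¹ * (jacProd (x * y) p * jacProd (x / y) p))
      = thetaOdd p x * thetaEven p y - thetaEven p x * thetaOdd p y := by
  have hxy := mul_ne_zero hx hy
  have hxy' := div_ne_zero hx hy
  have hf := summable_norm_thetaTerm hp0 hp hxy
  have hg := summable_norm_thetaTerm hp0 hp hxy'
  have sE : ∀ {x : ℂ}, x ≠ 0 → Summable fun n : ℤ => ‖p ^ n ^ 2 * x ^ (2 * n)‖ := by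
    intro x hx
    refine (summable_pow_quadratic_mul_zpow hp0 hp (pow_ne_zero 2 hx) one_ne_zero 0).congr
      fun n => ?_
    rw [← zpow_natCast, ← zpow_mul]; simp
  have sO : ∀ {x : ℂ}, x ≠ 0 → Summable fun n : ℤ => ‖p ^ (n ^ 2 - n) * x ^ (2 * n - 1)‖ := by
    intro x hx
    refine ((summable_pow_quadratic_mul_zpow hp0 hp (pow_ne_zero 2 hx)
      one_ne_zero (-1)).mul_right ‖x⁻¹‖).congr fun n => ?_
    rw [← norm_mul, ← zpow_natCast, ← zpow_mul, mul_assoc, zpow_sub_one₀ hx]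
    congr 2; congr 1; push_cast; ring
  have hfg := (summable_mul_of_summable_norm hf hg).hasSum
  rw [← tsum_mul_tsum_of_summable_norm hf hg, tsum_thetaTerm hp0 hp hxy,
    tsum_thetaTerm hp0 hp hxy'] at hfg
  rw [← (Equiv.ofBijective _ paritySplit_bijective).hasSum_iff] at hfg
  have h1 := ((summable_mul_of_summable_norm (sO hx) (sE hy)).hasSum).mul_left x
  have h2 := ((summable_mul_of_summable_norm (sE hx) (sO hy)).hasSum).mul_left (-x)
  rw [← tsum_mul_tsum_of_summable_norm (sO hx) (sE hy)] at h1
  rw [← tsum_mul_tsum_of_summable_norm (sE hx) (sO hy)] at h2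
  have half : ∀ n : ℤ, n * (n - 1) / 2 * 2 = n * (n - 1) := fun n =>
    Int.ediv_mul_cancel (Int.even_mul_pred_self n).two_dvd
  have hsplit : ∀ (m n c d e : ℤ), m * (m - 1) / 2 + n * (n - 1) / 2 = c → m + n = d →
      m - n = e → thetaTerm p (x * y) m * thetaTerm p (x / y) n
        = (-1) ^ d * (p ^ c * x ^ d * y ^ e) := by
    rintro m n c d e rfl rfl rfl
    unfold thetaTerm
    rw [zpow_add₀ hp0, zpow_add₀ hx, zpow_sub₀ hy, ← neg_one_mul, ← neg_one_mul (x / y),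
      mul_zpow, mul_zpow, mul_zpow, div_zpow, zpow_add₀ (neg_ne_zero.2 one_ne_zero)]
    ring
  have h3 := HasSum.sum (f := (fun c : ℤ × ℤ => thetaTerm p (x * y) c.1 * thetaTerm p (x / y) c.2)
      ∘ Equiv.ofBijective _ paritySplit_bijective)
      (h1.congr_fun fun ⟨a, b⟩ => ?_) (h2.congr_fun fun ⟨a, b⟩ => ?_)
  · have := h3.unique hfg
    rw [← thetaOdd, ← thetaEven, ← thetaOdd, ← thetaEven] at this
    have hxx := mul_inv_cancel₀ hx
    linear_combination (-x⁻¹) * this + (thetaOdd p x * thetaEven p y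
      - thetaEven p x * thetaOdd p y) * hxx
  · change thetaTerm p (x * y) (a + b) * thetaTerm p (x / y) (a - b) = _
    rw [hsplit (a + b) (a - b) (a ^ 2 - a + b ^ 2) (2 * a) (2 * b) (by
      have e1 := half (a + b)
      have e2 := half (a - b)
      have e3 : (a + b) * (a + b - 1) + (a - b) * (a - b - 1) = (a ^ 2 - a + b ^ 2) * 2 := by ring
      omega) (by ring) (by ring), zpow_add₀ hp0, zpow_sub_one₀ hx, zpow_mul (-1 : ℂ)]
    simp only [zpow_ofNat, neg_one_sq, one_zpow]
    field_simp
  · change thetaTerm p (x * y) (a + b) * thetaTerm p (x / y) (a - b + 1) = _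
    rw [hsplit (a + b) (a - b + 1) (a ^ 2 + (b ^ 2 - b)) (2 * a + 1) (2 * b - 1) (by
      have e1 := half (a + b)
      have e2 := half (a - b + 1)
      have e3 : (a + b) * (a + b - 1) + (a - b + 1) * (a - b + 1 - 1)
        = (a ^ 2 + (b ^ 2 - b)) * 2 := by ring
      omega) (by ring) (by ring), zpow_add₀ hp0, zpow_add_one₀ hx,
      zpow_add_one₀ (neg_ne_zero.2 one_ne_zero), zpow_mul (-1 : ℂ)]
    simp only [zpow_ofNat, neg_one_sq, one_zpow]
    ring

/-- A case of Weierstrass's relation: `θ(xy) θ(x/y)` has rank two in `x` and `y`, so the alternating sum below is a Plücker relation. -/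
theorem theta_three_term (hp0 : p ≠ 0) (hp : ‖p‖ < 1) {x y z : ℂ} (hx : x ≠ 0) (hy : y ≠ 0)
    (hz : z ≠ 0) :
    x⁻¹ * (jacProd (x * y) p * jacProd (x / y) p) * (z⁻¹ * jacProd z p ^ 2)
      - x⁻¹ * (jacProd (x * z) p * jacProd (x / z) p) * (y⁻¹ * jacProd y p ^ 2)
      + x⁻¹ * jacProd x p ^ 2 * (y⁻¹ * (jacProd (y * z) p * jacProd (y / z) p)) = 0 := by
  have hP := pow_ne_zero 4 (qPoch_self_ne_zero hp)
  have t := fun {x y : ℂ} (hx : x ≠ 0) (hy : y ≠ 0) => theta_mul_theta hp0 hp hx hy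
  have a1 := t hx hy
  have a2 := t hz one_ne_zero
  have a3 := t hx hz
  have a4 := t hy one_ne_zero
  have a5 := t hx one_ne_zero
  have a6 := t hy hz
  simp only [mul_one, div_one, ← pow_two] at a2 a4 a5
  refine mul_left_cancel₀ hP ?_
  rw [mul_zero]
  calc _ = (qPoch p p ^ 2 * (x⁻¹ * (jacProd (x * y) p * jacProd (x / y) p)))
          * (qPoch p p ^ 2 * (z⁻¹ * jacProd z p ^ 2))
        - (qPoch p p ^ 2 * (x⁻¹ * (jacProd (x * z) p * jacProd (x / z) p)))
          * (qPoch p p ^ 2 * (y⁻¹ * jacProd y p ^ 2))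
        + (qPoch p p ^ 2 * (x⁻¹ * jacProd x p ^ 2))
          * (qPoch p p ^ 2 * (y⁻¹ * (jacProd (y * z) p * jacProd (y / z) p))) := by ring
    _ = 0 := by rw [a1, a2, a3, a4, a5, a6]; ring

end

/-! ### Theta products and Lambert series of level nine -/

/-- The theta product `[q^k; q^9]_∞`, for `k ∈ ℤ`. -/
def jacNine (q : ℂ) (k : ℤ) : ℂ := jacProd (q ^ k) (q ^ 9)

/-- The generalised Lambert series `∑_n q^{18n² + en} / (1 - q^{9n+b})`, which is
`Σ(b, e - 18, 9)`. -/
def lambert (q : ℂ) (b e : ℤ) : ℂ := ∑' n : ℤ, q ^ (18 * n ^ 2 + e * n) / (1 - q ^ (9 * n + b))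

section
variable {q : ℂ}

theorem norm_pow_nine_lt_one (hq : ‖q‖ < 1) : ‖q ^ 9‖ < 1 := by
  rw [norm_pow]; exact pow_lt_one₀ (norm_nonneg q) hq (by norm_num)

theorem jacNine_neg (hq0 : q ≠ 0) (hq : ‖q‖ < 1) (k : ℤ) :
    jacNine q (-k) = -q ^ (-k) * jacNine q k := by
  unfold jacNine
  rw [zpow_neg, jacProd_inv (norm_pow_nine_lt_one hq) (zpow_ne_zero k hq0)]

theorem jacNine_nine_sub (hq0 : q ≠ 0) (k : ℤ) : jacNine q (9 - k) = jacNine q k := by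
  unfold jacNine
  rw [zpow_sub₀ hq0, ← jacProd_div (z := q ^ k) (pow_ne_zero 9 hq0)]
  norm_cast

theorem one_sub_zpow_mul_ne_zero (hq : ‖q‖ < 1) (hq0 : q ≠ 0) {k : ℤ} (hk : ¬ 9 ∣ k) (n : ℤ) :
    1 - q ^ k * (q ^ 9) ^ n ≠ 0 := by
  have : q ^ k * (q ^ 9) ^ n = q ^ (k + 9 * n) := by
    rw [zpow_add₀ hq0, zpow_mul]; norm_cast
  rw [this]
  exact sub_ne_zero.2 (zpow_ne_one_of_norm_lt_one hq (by omega)).symm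

theorem jacNine_ne_zero (hq0 : q ≠ 0) (hq : ‖q‖ < 1) {k : ℤ} (hk : ¬ 9 ∣ k) :
    jacNine q k ≠ 0 := by
  have h9 := norm_pow_nine_lt_one hq
  refine mul_ne_zero (qPoch_ne_zero h9 fun n => ?_) (qPoch_ne_zero h9 fun n => ?_)
  · simpa using one_sub_zpow_mul_ne_zero hq hq0 hk n
  · have := one_sub_zpow_mul_ne_zero hq hq0 (k := 9 - k) (by omega) n
    rw [zpow_sub₀ hq0] at this
    exact_mod_cast this

theorem hasSum_lambert (hq0 : q ≠ 0) (hq : ‖q‖ < 1) (b e : ℤ) :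
    HasSum (fun n : ℤ => q ^ (18 * n ^ 2 + e * n) / (1 - q ^ (9 * n + b))) (lambert q b e) := by
  have h := (summable_pow_quadratic_div (pow_ne_zero 9 hq0) (norm_pow_nine_lt_one hq)
    (zpow_ne_zero e hq0) (zpow_ne_zero b hq0) two_ne_zero 0).of_norm
  refine (h.congr fun n => ?_).hasSum
  rw [← zpow_natCast, ← zpow_mul, ← zpow_mul, ← zpow_mul, ← zpow_add₀ hq0, ← zpow_add₀ hq0]
  congr 2 <;> [skip; congr 1] <;> push_cast <;> ring

theorem SigmaInt_eq_lambert (hq0 : q ≠ 0) (b c : ℤ) :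
    SigmaInt q b c 9 = lambert q b (c + 18) := by
  refine tsum_congr fun n => ?_
  unfold SigmaTerm
  rw [← zpow_mul, ← zpow_mul, ← zpow_mul, ← zpow_add₀ hq0, ← zpow_add₀ hq0]
  congr 2 <;> [skip; congr 1] <;> ring

/-- The symmetry `n ↦ -n` of the Lambert series. -/
theorem lambert_reflect (hq0 : q ≠ 0) (b e : ℤ) :
    lambert q b e = -q ^ (-b) * lambert q (-b) (9 - e) := by
  unfold lambert
  rw [← (Equiv.neg ℤ).tsum_eq, ← tsum_mul_left]
  refine tsum_congr fun n => ?_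
  rw [Equiv.neg_apply]
  have e1 : q ^ (9 * -n + b) = (q ^ (9 * n - b))⁻¹ := by rw [← zpow_neg]; congr 1; ring
  have e2 : q ^ (18 * n ^ 2 + (9 - e) * n) = q ^ b * q ^ (9 * n - b) * q ^ (18 * n ^ 2 - e * n) := by
    rw [← zpow_add₀ hq0, ← zpow_add₀ hq0]; congr 1; ring
  have e3 : 18 * (-n) ^ 2 + e * -n = 18 * n ^ 2 - e * n := by ring
  have hx := zpow_ne_zero (9 * n - b) hq0
  have hb := zpow_ne_zero b hq0
  rw [e1, e2, e3, zpow_neg, ← sub_eq_add_neg]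
  generalize q ^ (9 * n - b) = x at *
  by_cases h1 : x = 1
  · simp [h1]
  have h2 : 1 - x ≠ 0 := sub_ne_zero.2 (Ne.symm h1)
  have h3 : x - 1 ≠ 0 := sub_ne_zero.2 h1
  field_simp
  ring

/-- `partialFraction` with modulus `q⁹` and poles at powers of `q`. -/
theorem partialFraction_nine (hq0 : q ≠ 0) (hq : ‖q‖ < 1) (β : Fin 4 → ℤ) (h1 : ∀ j, ¬ 9 ∣ β j)
    (h2 : ∀ j l, l ≠ j → ¬ 9 ∣ β l - β j) (d : ℤ) :
    qPoch (q ^ 9) (q ^ 9) ^ 2 * ∏ j, (jacNine q (β j))⁻¹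
      = ∑ j, q ^ (d * β j) * (∏ l ∈ univ.erase j, (jacNine q (β l - β j))⁻¹)
          * lambert q (β j) (18 + 9 * d + 4 * β j - ∑ l, β l) := by
  have h := partialFraction (p := q ^ 9) (b := fun j => q ^ β j) (pow_ne_zero 9 hq0)
    (norm_pow_nine_lt_one hq) (fun j => zpow_ne_zero _ hq0)
    (fun j n => one_sub_zpow_mul_ne_zero hq hq0 (h1 j) n)
    (fun j l hl n => by
      rw [← zpow_sub₀ hq0]; exact one_sub_zpow_mul_ne_zero hq hq0 (h2 j l hl) n) d
  simp only [← zpow_sub₀ hq0] at h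
  refine h.trans (sum_congr rfl fun j _ => ?_)
  have e1 : SigmaSeries (q ^ β j) ((q ^ 9) ^ d * (q ^ β j) ^ 4 / ∏ l, q ^ β l) (q ^ 9)
      = lambert q (β j) (18 + 9 * d + 4 * β j - ∑ l, β l) := by
    have := SigmaInt_eq_lambert hq0 (β j) (9 * d + β j * 4 - ∑ l, β l)
    rw [show 18 + 9 * d + 4 * β j - ∑ l, β l = 9 * d + β j * 4 - ∑ l, β l + 18 by ring, ← this,
      SigmaInt]
    have e : ∏ l, q ^ β l = q ^ ∑ l, β l := by
      simp only [Fin.prod_univ_four, Fin.sum_univ_four, zpow_add₀ hq0]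
    rw [e, zpow_sub₀ hq0, zpow_add₀ hq0, zpow_mul, zpow_mul]
    norm_cast
  rw [e1, mul_comm d, zpow_mul]
  rfl

/-- The relation `[q²]² [q⁴] = q [q]² [q²] + [q⁴]² [q]` between theta products of modulus `q⁹`. -/
theorem jacNine_cubic (hq0 : q ≠ 0) (hq : ‖q‖ < 1) :
    jacNine q 2 ^ 2 * jacNine q 4
      = q * jacNine q 1 ^ 2 * jacNine q 2 + jacNine q 4 ^ 2 * jacNine q 1 := by
  have h := theta_three_term (p := q ^ 9) (pow_ne_zero 9 hq0) (norm_pow_nine_lt_one hq)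
    (zpow_ne_zero 4 hq0) (zpow_ne_zero 1 hq0) (zpow_ne_zero 2 hq0)
  simp only [← zpow_sub₀ hq0, ← zpow_add₀ hq0] at h
  norm_num only at h
  simp only [← jacNine.eq_1] at h
  have j5 : jacNine q 5 = jacNine q 4 := jacNine_nine_sub hq0 4
  have j6 : jacNine q 6 = jacNine q 3 := jacNine_nine_sub hq0 3
  have jm : jacNine q (-1) = -q ^ (-1 : ℤ) * jacNine q 1 := jacNine_neg hq0 hq 1
  have h3 := jacNine_ne_zero hq0 hq (k := 3) (by norm_num)
  rw [j5, j6, jm] at h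
  refine mul_left_cancel₀ h3 ?_
  simp only [zpow_neg, zpow_ofNat] at h
  field_simp at h
  linear_combination h

end

/-! ### Relations between Lambert series -/

section
variable {q : ℂ}

theorem partialFraction_nine_expanded (hq0 : q ≠ 0) (hq : ‖q‖ < 1) (β₀ β₁ β₂ β₃ d : ℤ)
    (h1 : ∀ j, ¬ 9 ∣ ![β₀, β₁, β₂, β₃] j)
    (h2 : ∀ j l, l ≠ j → ¬ 9 ∣ ![β₀, β₁, β₂, β₃] l - ![β₀, β₁, β₂, β₃] j) :
    qPoch (q ^ 9) (q ^ 9) ^ 2 / (jacNine q β₀ * jacNine q β₁ * jacNine q β₂ * jacNine q β₃)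
      = q ^ (d * β₀) / (jacNine q (β₁ - β₀) * jacNine q (β₂ - β₀) * jacNine q (β₃ - β₀))
          * lambert q β₀ (18 + 9 * d + 4 * β₀ - (β₀ + β₁ + β₂ + β₃))
        + q ^ (d * β₁) / (jacNine q (β₀ - β₁) * jacNine q (β₂ - β₁) * jacNine q (β₃ - β₁))
          * lambert q β₁ (18 + 9 * d + 4 * β₁ - (β₀ + β₁ + β₂ + β₃))
        + q ^ (d * β₂) / (jacNine q (β₀ - β₂) * jacNine q (β₁ - β₂) * jacNine q (β₃ - β₂))
          * lambert q β₂ (18 + 9 * d + 4 * β₂ - (β₀ + β₁ + β₂ + β₃))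
        + q ^ (d * β₃) / (jacNine q (β₀ - β₃) * jacNine q (β₁ - β₃) * jacNine q (β₂ - β₃))
          * lambert q β₃ (18 + 9 * d + 4 * β₃ - (β₀ + β₁ + β₂ + β₃)) := by
  have h := partialFraction_nine hq0 hq ![β₀, β₁, β₂, β₃] h1 h2 d
  have u0 : univ.erase (0 : Fin 4) = {1, 2, 3} := by decide
  have u1 : univ.erase (1 : Fin 4) = {0, 2, 3} := by decide
  have u2 : univ.erase (2 : Fin 4) = {0, 1, 3} := by decide
  have u3 : univ.erase (3 : Fin 4) = {0, 1, 2} := by decide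
  simp [Fin.prod_univ_four, Fin.sum_univ_four, u0, u1, u2, u3] at h
  simp only [div_eq_mul_inv, mul_inv]
  linear_combination h

/-- Reduction of the theta products to the arguments `q`, `q²`, `q³`, `q⁴`. -/
theorem jacNine_reduce (hq0 : q ≠ 0) (hq : ‖q‖ < 1) :
    jacNine q 5 = jacNine q 4 ∧ jacNine q 6 = jacNine q 3 ∧ jacNine q 8 = jacNine q 1 ∧
    jacNine q (-1) = -(q ^ 1)⁻¹ * jacNine q 1 ∧ jacNine q (-2) = -(q ^ 2)⁻¹ * jacNine q 2 ∧
    jacNine q (-3) = -(q ^ 3)⁻¹ * jacNine q 3 ∧ jacNine q (-4) = -(q ^ 4)⁻¹ * jacNine q 4 ∧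
    jacNine q (-5) = -(q ^ 5)⁻¹ * jacNine q 4 ∧ jacNine q (-6) = -(q ^ 6)⁻¹ * jacNine q 3 ∧
    jacNine q (-8) = -(q ^ 8)⁻¹ * jacNine q 1 := by
  have j5 : jacNine q 5 = jacNine q 4 := jacNine_nine_sub hq0 4
  have j6 : jacNine q 6 = jacNine q 3 := jacNine_nine_sub hq0 3
  have j8 : jacNine q 8 = jacNine q 1 := jacNine_nine_sub hq0 1
  have hn : ∀ k : ℕ, jacNine q (-k) = -(q ^ k)⁻¹ * jacNine q k := fun k => by
    rw [jacNine_neg hq0 hq, zpow_neg, zpow_natCast]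
  exact ⟨j5, j6, j8, hn 1, hn 2, hn 3, hn 4, j5 ▸ hn 5, j6 ▸ hn 6, j8 ▸ hn 8⟩

theorem jacNine_ne_zeros (hq0 : q ≠ 0) (hq : ‖q‖ < 1) :
    jacNine q 1 ≠ 0 ∧ jacNine q 2 ≠ 0 ∧ jacNine q 3 ≠ 0 ∧ jacNine q 4 ≠ 0 := by
  refine ⟨?_, ?_, ?_, ?_⟩ <;> exact jacNine_ne_zero hq0 hq (by norm_num)

/-- Partial fractions with poles at `q^{±1}` and `q^{±2}`. -/
theorem lambert_relation_one_two (hq0 : q ≠ 0) (hq : ‖q‖ < 1) :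
    jacNine q 1 * jacNine q 2 *
      (jacNine q 2 * (q * lambert q (-2) (-8) + q⁻¹ * lambert q (-2) 1)
        + jacNine q 4 * (lambert q 1 4 + q * lambert q 1 13))
      = qPoch (q ^ 9) (q ^ 9) ^ 2 * jacNine q 3 * jacNine q 4 := by
  have h := partialFraction_nine_expanded hq0 hq 2 (-2) 1 (-1) (-2) (by decide) (by decide)
  have r1 := lambert_reflect hq0 2 8
  have r2 := lambert_reflect hq0 (-1) (-4)
  obtain ⟨-, -, -, n1, n2, n3, n4, -, -, -⟩ := jacNine_reduce hq0 hq
  obtain ⟨z1, z2, z3, z4⟩ := jacNine_ne_zeros hq0 hq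
  norm_num at h r1 r2 n1 n2 n3 n4
  rw [r1, r2, n1, n2, n3, n4] at h
  field_simp at h ⊢
  linear_combination -h

/-- Partial fractions with poles at `q`, `q²`, `q⁴` and `q⁻⁴`. -/
theorem lambert_relation_one_two_four (hq0 : q ≠ 0) (hq : ‖q‖ < 1) :
    jacNine q 4 * (jacNine q 4 * (lambert q (-2) (-5) + q ^ 6 * lambert q 4 22)
        + jacNine q 2 * (q * lambert q 1 10 + q ^ 5 * lambert q 4 19))
      = q * qPoch (q ^ 9) (q ^ 9) ^ 2 * jacNine q 3 := by
  have h := partialFraction_nine_expanded hq0 hq 2 4 1 (-4) (-1) (by decide) (by decide)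
  have r1 := lambert_reflect hq0 2 14
  have r2 := lambert_reflect hq0 (-4) (-10)
  obtain ⟨j5, j6, j8, n1, n2, n3, n4, n5, n6, n8⟩ := jacNine_reduce hq0 hq
  obtain ⟨z1, z2, z3, z4⟩ := jacNine_ne_zeros hq0 hq
  norm_num at h r1 r2 n1 n2 n3 n4 n5 n6 n8
  rw [r1, r2, j5, j6, j8, n1, n2, n3, n4, n5, n6, n8] at h
  field_simp at h ⊢
  linear_combination h

/-- Partial fractions with poles at `q^{±1}` and `q^{±4}`. -/
theorem lambert_relation_one_four (hq0 : q ≠ 0) (hq : ‖q‖ < 1) :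
    jacNine q 1 * jacNine q 4 *
      (jacNine q 2 * (q ^ 3 * lambert q 4 16 + q ^ 7 * lambert q 4 25)
        - jacNine q 1 * (lambert q 1 4 + q * lambert q 1 13))
      = -(qPoch (q ^ 9) (q ^ 9) ^ 2 * jacNine q 2 * jacNine q 3) := by
  have h := partialFraction_nine_expanded hq0 hq 4 (-4) 1 (-1) (-2) (by decide) (by decide)
  have r1 := lambert_reflect hq0 (-4) (-16)
  have r2 := lambert_reflect hq0 (-1) (-4)
  obtain ⟨j5, j6, j8, n1, n2, n3, n4, n5, n6, n8⟩ := jacNine_reduce hq0 hq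
  obtain ⟨z1, z2, z3, z4⟩ := jacNine_ne_zeros hq0 hq
  norm_num at h r1 r2 n1 n2 n3 n4 n5 n6 n8
  rw [r1, r2, j5, j8, n1, n2, n3, n4, n5, n8] at h
  field_simp at h ⊢
  linear_combination h

/-- Partial fractions with poles at `q`, `q⁻¹`, `q⁻²` and `q⁻⁴`. -/
theorem lambert_relation_mixed (hq0 : q ≠ 0) (hq : ‖q‖ < 1) :
    jacNine q 1 * (jacNine q 4 * (lambert q 1 7 + q⁻¹ * lambert q (-2) (-2))
        + jacNine q 1 * (q * lambert q 1 10 + q ^ 5 * lambert q 4 19))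
      = qPoch (q ^ 9) (q ^ 9) ^ 2 * jacNine q 3 := by
  have h := partialFraction_nine_expanded hq0 hq (-1) (-2) 1 (-4) (-2) (by decide) (by decide)
  have r1 := lambert_reflect hq0 (-1) 2
  have r2 := lambert_reflect hq0 (-4) (-10)
  obtain ⟨j5, j6, j8, n1, n2, n3, n4, n5, n6, n8⟩ := jacNine_reduce hq0 hq
  obtain ⟨z1, z2, z3, z4⟩ := jacNine_ne_zeros hq0 hq
  norm_num at h r1 r2 n1 n2 n3 n4 n5 n6 n8
  rw [r1, r2, j5, n1, n2, n3, n4, n5] at h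
  field_simp at h ⊢
  linear_combination h

end

/-! ### Trisection of products and series -/

/-- The integers split into the residue classes `0`, `1` and `-1` modulo `3`. -/
def residueSplit : ℤ ⊕ (ℤ ⊕ ℤ) → ℤ :=
  Sum.elim (fun n => 3 * n) (Sum.elim (fun n => 3 * n + 1) fun n => 3 * n - 1)

theorem residueSplit_bijective : Function.Bijective residueSplit := by
  constructor
  · rintro (a | a | a) (b | b | b) h <;>
      simp only [residueSplit, Sum.elim_inl, Sum.elim_inr, Sum.inl.injEq, Sum.inr.injEq,
        reduceCtorEq] at h ⊢ <;> omega
  · intro n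
    have : n % 3 = 0 ∨ n % 3 = 1 ∨ n % 3 = 2 := by omega
    rcases this with h | h | h
    · exact ⟨.inl (n / 3), by simp only [residueSplit, Sum.elim_inl]; omega⟩
    · exact ⟨.inr (.inl (n / 3)), by simp only [residueSplit, Sum.elim_inl, Sum.elim_inr]; omega⟩
    · exact ⟨.inr (.inr ((n + 1) / 3)), by simp only [residueSplit, Sum.elim_inr]; omega⟩

theorem hasSum_int_of_residues {f : ℤ → ℂ} {a b c : ℂ} (h0 : HasSum (fun n => f (3 * n)) a)
    (h1 : HasSum (fun n => f (3 * n + 1)) b) (h2 : HasSum (fun n => f (3 * n - 1)) c) :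
    HasSum f (a + (b + c)) := by
  rw [← (Equiv.ofBijective _ residueSplit_bijective).hasSum_iff]
  exact HasSum.sum h0 (HasSum.sum h1 h2)

section
variable {q : ℂ}

theorem qPoch_trisect (z : ℂ) (hq : ‖q‖ < 1) :
    qPoch z q = qPoch z (q ^ 3) * qPoch (z * q) (q ^ 3) * qPoch (z * q ^ 2) (q ^ 3) := by
  have h3 : ‖q ^ 3‖ < 1 := by rw [norm_pow]; exact pow_lt_one₀ (norm_nonneg q) hq (by norm_num)
  have hfin : ∀ n, qPochFin z q (n * 3)
      = qPochFin z (q ^ 3) n * qPochFin (z * q) (q ^ 3) n * qPochFin (z * q ^ 2) (q ^ 3) n := by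
    intro n
    induction n with
    | zero => simp [qPochFin]
    | succ n ih =>
      rw [show (n + 1) * 3 = n * 3 + 1 + 1 + 1 by ring, qPochFin_succ, qPochFin_succ, qPochFin_succ,
        ih, qPochFin_succ, qPochFin_succ, qPochFin_succ]
      ring
  have h := (tendsto_qPochFin z hq).comp (tendsto_id.atTop_mul_const' (three_pos : 0 < 3))
  refine tendsto_nhds_unique (h.congr hfin) ?_
  exact ((tendsto_qPochFin z h3).mul (tendsto_qPochFin _ h3)).mul (tendsto_qPochFin _ h3)

/-- The trisection of `(t; t)_∞`, with theta products of modulus `(t³)⁹`. -/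
theorem qPoch_self_trisect {t : ℂ} (ht0 : t ≠ 0) (ht : ‖t‖ < 1) :
    qPoch t t = qPoch ((t ^ 3) ^ 9) ((t ^ 3) ^ 9) *
      (jacNine (t ^ 3) 4 - t * jacNine (t ^ 3) 2 - t ^ 2 * jacNine (t ^ 3) 1) := by
  have h3 : ‖t ^ 3‖ < 1 := by rw [norm_pow]; exact pow_lt_one₀ (norm_nonneg t) ht (by norm_num)
  have hq0 := pow_ne_zero 3 ht0
  have hp0 := pow_ne_zero 9 hq0
  have hp := norm_pow_nine_lt_one h3
  have hprod : qPoch t t = qPoch (t ^ 3) (t ^ 3) * jacProd t (t ^ 3) := by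
    rw [qPoch_trisect t ht, jacProd, show t ^ 3 / t = t * t by field_simp,
      show t * t ^ 2 = t ^ 3 by ring]
    ring
  have half : ∀ n : ℤ, n * (n - 1) / 2 * 2 = n * (n - 1) := fun n =>
    Int.ediv_mul_cancel (Int.even_mul_pred_self n).two_dvd
  have hs : ∀ k : ℤ, HasSum (thetaTerm ((t ^ 3) ^ 9) ((t ^ 3) ^ k))
      (qPoch ((t ^ 3) ^ 9) ((t ^ 3) ^ 9) * jacNine (t ^ 3) k) := by
    intro k
    rw [jacNine, ← tsum_thetaTerm hp0 hp (zpow_ne_zero k hq0)]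
    exact (summable_norm_thetaTerm hp0 hp (zpow_ne_zero k hq0)).of_norm.hasSum
  have hterm : ∀ k n : ℤ, thetaTerm ((t ^ 3) ^ 9) ((t ^ 3) ^ k) n
      = (-1) ^ n * t ^ (27 * (n * (n - 1) / 2) + 3 * k * n) := by
    intro k n
    rw [thetaTerm, ← neg_one_mul, mul_zpow, zpow_add₀ ht0, ← pow_mul, ← zpow_natCast t 27,
      ← zpow_natCast t 3, ← zpow_mul, ← zpow_mul, ← zpow_mul]
    push_cast
    ring_nf
  have hterm' : ∀ n : ℤ, thetaTerm (t ^ 3) t n = (-1) ^ n * t ^ (3 * (n * (n - 1) / 2) + n) := by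
    intro n
    rw [thetaTerm, ← neg_one_mul, mul_zpow, zpow_add₀ ht0, ← zpow_natCast t 3, ← zpow_mul]
    push_cast
    ring_nf
  have hsign : ∀ n : ℤ, (-1 : ℂ) ^ (3 * n) = (-1) ^ n := fun n => by rw [zpow_mul]; norm_num
  have hm1 : (-1 : ℂ) ≠ 0 := neg_ne_zero.2 one_ne_zero
  have h := hasSum_int_of_residues (f := thetaTerm (t ^ 3) t) (a := _) (b := _) (c := _)
    ((hs 4).congr_fun fun n => ?_) (((hs 7).mul_left (-t)).congr_fun fun n => ?_)
    (((hs 1).mul_left (-t ^ 2)).congr_fun fun n => ?_)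
  · have j7 : jacNine (t ^ 3) 7 = jacNine (t ^ 3) 2 := jacNine_nine_sub hq0 2
    rw [hprod, ← tsum_thetaTerm hq0 h3 ht0, h.tsum_eq, j7]
    ring
  · rw [hterm, hterm', hsign]
    congr 2
    have h1 := half n
    have h2 := half (3 * n)
    have h3 : 3 * n * (3 * n - 1) = 9 * (n * (n - 1)) + 6 * n := by ring
    omega
  · rw [hterm, hterm', zpow_add_one₀ hm1, hsign]
    have h1 := half n
    have h2 := half (3 * n + 1)
    have h3 : (3 * n + 1) * (3 * n + 1 - 1) = 9 * (n * (n - 1)) + 12 * n := by ring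
    rw [show 3 * ((3 * n + 1) * (3 * n + 1 - 1) / 2) + (3 * n + 1)
      = 27 * (n * (n - 1) / 2) + 3 * 7 * n + 1 by omega, zpow_add_one₀ ht0]
    ring
  · rw [hterm, hterm', zpow_sub_one₀ hm1, hsign]
    have h1 := half n
    have h2 := half (3 * n - 1)
    have h3 : (3 * n - 1) * (3 * n - 1 - 1) = 9 * (n * (n - 1)) + 2 := by ring
    rw [show 3 * ((3 * n - 1) * (3 * n - 1 - 1) / 2) + (3 * n - 1)
      = 27 * (n * (n - 1) / 2) + 3 * 1 * n + 2 by omega, zpow_add₀ ht0 _ 2]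
    norm_num
    ring

theorem A1_eq (hq0 : q ≠ 0) (hq : ‖q‖ < 1) :
    A1 q = qPoch (q ^ 9) (q ^ 9) * jacNine q 3
      / (jacNine q 1 * jacNine q 2 * jacNine q 4) := by
  have h3 : ‖q ^ 3‖ < 1 := by rw [norm_pow]; exact pow_lt_one₀ (norm_nonneg q) hq (by norm_num)
  have e9 : (q ^ 3) ^ 3 = q ^ 9 := by ring
  unfold A1 jacProd jacNine jacProd
  rw [qPoch_trisect (q ^ 3) h3, qPoch_trisect q h3, qPoch_trisect (q ^ 3 / q) h3, e9]
  norm_cast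
  rw [show q ^ 3 * q ^ 3 = q ^ 6 by ring, show q ^ 3 * (q ^ 3) ^ 2 = q ^ 9 by ring,
    show q * q ^ 3 = q ^ 4 by ring, show q * (q ^ 3) ^ 2 = q ^ 7 by ring,
    show q ^ 3 / q = q ^ 2 by field_simp,
    show q ^ 2 * q ^ 3 = q ^ 5 by ring, show q ^ 2 * (q ^ 3) ^ 2 = q ^ 8 by ring,
    show q ^ 9 / q ^ 1 = q ^ 8 by field_simp, show q ^ 9 / q ^ 2 = q ^ 7 by field_simp,
    show q ^ 9 / q ^ 3 = q ^ 6 by field_simp, show q ^ 9 / q ^ 4 = q ^ 5 by field_simp, pow_one]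
  congr 1 <;> ring

theorem A0_eq (hq0 : q ≠ 0) :
    A0 q = qPoch (q ^ 9) (q ^ 9) * jacNine q 3 / (jacNine q 1 ^ 2 * jacNine q 4)
      - (lambert q 1 4 + q * lambert q 1 13) / (qPoch (q ^ 9) (q ^ 9) * jacNine q 2)
      - (q * lambert q 1 10 + q ^ 5 * lambert q 4 19) / (qPoch (q ^ 9) (q ^ 9) * jacNine q 4) := by
  unfold A0
  simp only [SigmaInt_eq_lambert hq0]
  norm_num
  unfold jacNine
  norm_cast
  rw [pow_one]
  ring

end

section
variable {t : ℂ}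

/-- The trisection of the bilateral series for `ST(ζ, t)`. -/
theorem hasSum_trisect {ζ : ℂ} (hζ : IsPrimitiveRoot ζ 3) (ht0 : t ≠ 0) (ht : ‖t‖ < 1) :
    HasSum (fun r : ℤ => baileyCoeff t r * baileyKernel ζ t (3 * r + 1))
      ((t * (lambert (t ^ 3) 1 4 + t ^ 3 * lambert (t ^ 3) 1 13) - t ^ 3 * lambert (t ^ 3) 1 10
          - t ^ 2 * lambert (t ^ 3) 1 7)
        + ((t ^ 2 * ((t ^ 3) ^ 3 * lambert (t ^ 3) 4 16 + (t ^ 3) ^ 7 * lambert (t ^ 3) 4 25)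
          - (t ^ 3) ^ 5 * lambert (t ^ 3) 4 19 - t * ((t ^ 3) ^ 6 * lambert (t ^ 3) 4 22))
        + ((t ^ 3 * lambert (t ^ 3) (-2) (-8) + (t ^ 3)⁻¹ * lambert (t ^ 3) (-2) 1)
          - t * lambert (t ^ 3) (-2) (-5) - t ^ 2 * ((t ^ 3)⁻¹ * lambert (t ^ 3) (-2) (-2))))) := by
  have hq0 := pow_ne_zero 3 ht0
  have h3 : ‖t ^ 3‖ < 1 := by rw [norm_pow]; exact pow_lt_one₀ (norm_nonneg t) ht (by norm_num)
  have H := fun b e => hasSum_lambert hq0 h3 b e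
  -- the minimal equation of `ζ` turns the kernel into `x / (1 + x + x²)` with `x = t^{3r+1}`
  have hζ1 : ζ ^ 2 + ζ + 1 = 0 := by
    have h1 := hζ.ne_one (by norm_num)
    have h2 := hζ.pow_eq_one
    refine mul_left_cancel₀ (sub_ne_zero.2 h1) ?_
    linear_combination h2
  have hζ0 := hζ.ne_zero (by norm_num)
  have hterm : ∀ r : ℤ, baileyCoeff t r * baileyKernel ζ t (3 * r + 1)
      = t ^ (6 * r ^ 2 + 4 * r + 1) * (1 - t ^ (3 * r + 1) - (t ^ (3 * r + 1)) ^ 2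
        + (t ^ (3 * r + 1)) ^ 3) / (1 - (t ^ (3 * r + 1)) ^ 3) := by
    intro r
    unfold baileyCoeff baileyKernel
    have hx1 : 1 - t ^ (3 * r + 1) ≠ 0 :=
      sub_ne_zero.2 (zpow_ne_one_of_norm_lt_one ht (by omega)).symm
    have hx3 : 1 - (t ^ (3 * r + 1)) ^ 3 ≠ 0 := by
      rw [← zpow_natCast, ← zpow_mul]
      exact sub_ne_zero.2 (zpow_ne_one_of_norm_lt_one ht (by push_cast; omega)).symm
    rw [show 6 * r ^ 2 + 4 * r + 1 = 6 * r ^ 2 + r + (3 * r + 1) by ring, zpow_add₀ ht0 (_ + _),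
      show t ^ (6 * r + 2) = (t ^ (3 * r + 1)) ^ 2 by
        rw [← zpow_natCast, ← zpow_mul]; congr 1; push_cast; ring]
    generalize t ^ (3 * r + 1) = x at *
    have hden : (1 - ζ * x) * (1 - ζ⁻¹ * x) = 1 + x + x ^ 2 := by
      field_simp
      linear_combination (-x) * hζ1
    have hfac : 1 - x ^ 3 = (1 - x) * (1 + x + x ^ 2) := by ring
    have hx2 : 1 + x + x ^ 2 ≠ 0 := fun h => hx3 (by rw [hfac, h, mul_zero])
    rw [hden, hfac]
    field_simp
    ring
  have P1 : ∀ b c n : ℤ, t ^ (b * n + c) = (t ^ n) ^ b * t ^ c := fun b c n => by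
    rw [zpow_add₀ ht0, mul_comm b, zpow_mul]
  have P2 : ∀ b c n : ℤ, t ^ (54 * n ^ 2 + b * n + c) = t ^ (54 * n ^ 2) * (t ^ n) ^ b * t ^ c :=
    fun b c n => by rw [add_assoc, zpow_add₀ ht0, P1, mul_assoc]
  have T : ∀ b e n : ℤ, (t ^ 3) ^ (18 * n ^ 2 + e * n) / (1 - (t ^ 3) ^ (9 * n + b))
      = t ^ (54 * n ^ 2) * (t ^ n) ^ (3 * e) / (1 - (t ^ n) ^ (27 : ℤ) * t ^ (3 * b)) := by
    intro b e n
    have h2 := P2 (3 * e) 0 n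
    rw [zpow_zero, mul_one] at h2
    rw [← P1, ← h2, ← zpow_natCast, ← zpow_mul, ← zpow_mul]
    congr 2 <;> [skip; congr 1] <;> push_cast <;> ring
  simp only [T] at H
  refine hasSum_int_of_residues ?_ ?_ ?_
  · refine (((((H 1 4).add ((H 1 13).mul_left (t ^ 3))).mul_left t).sub
      ((H 1 10).mul_left (t ^ 3))).sub ((H 1 7).mul_left (t ^ 2))).congr_fun fun n => ?_
    rw [hterm, show 6 * (3 * n) ^ 2 + 4 * (3 * n) + 1 = 54 * n ^ 2 + 12 * n + 1 by ring, P2,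
      show 3 * (3 * n) + 1 = 9 * n + 1 by ring, P1]
    norm_num
    ring
  · refine ((((((H 4 16).mul_left ((t ^ 3) ^ 3)).add ((H 4 25).mul_left ((t ^ 3) ^ 7))).mul_left
      (t ^ 2)).sub ((H 4 19).mul_left ((t ^ 3) ^ 5))).sub
      (((H 4 22).mul_left ((t ^ 3) ^ 6)).mul_left t)).congr_fun fun n => ?_
    rw [hterm, show 6 * (3 * n + 1) ^ 2 + 4 * (3 * n + 1) + 1 = 54 * n ^ 2 + 48 * n + 11 by ring,
      P2, show 3 * (3 * n + 1) + 1 = 9 * n + 4 by ring, P1]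
    norm_num
    ring
  · refine (((((H (-2) (-8)).mul_left (t ^ 3)).add ((H (-2) 1).mul_left (t ^ 3)⁻¹)).sub
      ((H (-2) (-5)).mul_left t)).sub
      (((H (-2) (-2)).mul_left (t ^ 3)⁻¹).mul_left (t ^ 2))).congr_fun fun n => ?_
    rw [hterm, show 6 * (3 * n - 1) ^ 2 + 4 * (3 * n - 1) + 1 = 54 * n ^ 2 + (-24) * n + 3 by ring,
      P2, show 3 * (3 * n - 1) + 1 = 9 * n + (-2) by ring, P1]
    have hy := zpow_ne_zero n ht0
    generalize t ^ n = y at *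
    norm_num
    rw [show ((y ^ 9 * (t ^ 2)⁻¹) ^ 3) = y ^ 27 * (t ^ 6)⁻¹ by
      field_simp]
    generalize (1 - y ^ 27 * (t ^ 6)⁻¹) = D
    field_simp
    ring

end

/-! ### Comparison of the residue classes of exponents -/

section
variable {q : ℂ}

/-- The three components of the dissection: the Lambert series with exponents in a residue class
modulo `3` equal the corresponding component of `(t; t)_∞ (A₀(t³) + t A₁(t³))`, where `q = t³`. -/
theorem trisection_components {q : ℂ} (hq0 : q ≠ 0) (hq : ‖q‖ < 1) :
    (q * lambert q (-2) (-8) + q⁻¹ * lambert q (-2) 1)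
        - (q * lambert q 1 10 + q ^ 5 * lambert q 4 19)
      = qPoch (q ^ 9) (q ^ 9) * (jacNine q 4 * A0 q - q * jacNine q 1 * A1 q) ∧
    (lambert q 1 4 + q * lambert q 1 13) - (lambert q (-2) (-5) + q ^ 6 * lambert q 4 22)
      = qPoch (q ^ 9) (q ^ 9) * (jacNine q 4 * A1 q - jacNine q 2 * A0 q) ∧
    (q ^ 3 * lambert q 4 16 + q ^ 7 * lambert q 4 25)
        - (lambert q 1 7 + q⁻¹ * lambert q (-2) (-2))
      = -(qPoch (q ^ 9) (q ^ 9) * (jacNine q 2 * A1 q + jacNine q 1 * A0 q)) := by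
  have hE := qPoch_self_ne_zero (norm_pow_nine_lt_one hq)
  obtain ⟨z1, z2, z3, z4⟩ := jacNine_ne_zeros hq0 hq
  have R0 := lambert_relation_one_two hq0 hq
  have R1 := lambert_relation_one_two_four hq0 hq
  have R2 := lambert_relation_one_four hq0 hq
  have R3 := lambert_relation_mixed hq0 hq
  have C := jacNine_cubic hq0 hq
  rw [A0_eq hq0, A1_eq hq0 hq]
  generalize q * lambert q (-2) (-8) + q⁻¹ * lambert q (-2) 1 = W at *
  generalize lambert q 1 4 + q * lambert q 1 13 = X at *
  generalize q * lambert q 1 10 + q ^ 5 * lambert q 4 19 = Y at *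
  generalize lambert q (-2) (-5) + q ^ 6 * lambert q 4 22 = U at *
  generalize q ^ 3 * lambert q 4 16 + q ^ 7 * lambert q 4 25 = V at *
  generalize lambert q 1 7 + q⁻¹ * lambert q (-2) (-2) = V' at *
  generalize qPoch (q ^ 9) (q ^ 9) = E at *
  generalize jacNine q 1 = a at *
  generalize jacNine q 2 = b at *
  generalize jacNine q 3 = c at *
  generalize jacNine q 4 = d at *
  refine ⟨?_, ?_, ?_⟩
  · field_simp
    refine mul_left_cancel₀ z2 ?_
    linear_combination a * d * R0 - E ^ 2 * c * C
  · field_simp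
    refine mul_left_cancel₀ z4 ?_
    linear_combination -(a ^ 2 * b) * R1 + E ^ 2 * c * C
  · field_simp
    linear_combination R2 - b * R3

end

end PartitionPairs

end

theorem theorem2 (ζ q : ℂ) (hζ : IsPrimitiveRoot ζ 3) (hq0 : q ≠ 0) (hq1 : ‖q‖ < 1) :
    -- the four bilateral series in `A₀` converge at every point of the punctured disc
    Summable (PartitionPairs.SigmaTerm (q ^ (1 : ℤ)) (q ^ (-14 : ℤ)) (q ^ (9 : ℤ))) ∧
    Summable (PartitionPairs.SigmaTerm (q ^ (1 : ℤ)) (q ^ (-5 : ℤ)) (q ^ (9 : ℤ))) ∧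
    Summable (PartitionPairs.SigmaTerm (q ^ (1 : ℤ)) (q ^ (-8 : ℤ)) (q ^ (9 : ℤ))) ∧
    Summable (PartitionPairs.SigmaTerm (q ^ (4 : ℤ)) (q ^ (1 : ℤ)) (q ^ (9 : ℤ))) ∧
    -- the series defining `ST(ζ, q)` converges, and its sum has the stated 3-dissection
    Summable (fun n : ℕ => PartitionPairs.STTerm ζ q (n + 1)) ∧
    PartitionPairs.ST ζ q =
      PartitionPairs.A0 (q ^ 3) + q * PartitionPairs.A1 (q ^ 3)
        + q ^ 2 * PartitionPairs.A2 (q ^ 3) := by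
  open PartitionPairs in
  have hS : ∀ b c : ℤ, Summable (SigmaTerm (q ^ b) (q ^ c) (q ^ (9 : ℤ))) := fun b c => by
    have h9 : ‖q ^ (9 : ℤ)‖ < 1 := by exact_mod_cast norm_pow_nine_lt_one hq1
    exact (summable_norm_SigmaTerm (zpow_ne_zero 9 hq0) h9 (zpow_ne_zero c hq0)
      (zpow_ne_zero b hq0)).of_norm
  have hζ0 := hζ.ne_zero (by norm_num)
  -- for `k > 0` the norms of `ξ` and `q^k` differ, so no denominator of `ST` vanishes
  have hne : ∀ ξ : ℂ, IsPrimitiveRoot ξ 3 → ∀ k : ℕ, 1 - ξ * q ^ k ≠ 0 := by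
    intro ξ hξ k h
    have h1 : q ^ (3 * k) = 1 := by
      have : (ξ * q ^ k) ^ 3 = 1 := by rw [← sub_eq_zero.1 h, one_pow]
      rw [mul_pow, hξ.pow_eq_one, one_mul] at this
      rw [← this]; ring
    rcases Nat.eq_zero_or_pos k with rfl | hk
    · rw [pow_zero, mul_one] at h
      exact hξ.ne_one (by norm_num) (sub_eq_zero.1 h).symm
    · exact PartitionPairs.pow_ne_one_of_norm_lt_one hq1 (by omega) h1
  have h1 := hne ζ hζ
  have h2 := hne ζ⁻¹ hζ.inv
  refine ⟨hS 1 (-14), hS 1 (-5), hS 1 (-8), hS 4 1,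
    (summable_nat_add_iff 1).2 (PartitionPairs.summable_STTerm hq0 hq1 h1 h2), ?_⟩
  have h3 : ‖q ^ 3‖ < 1 := by rw [norm_pow]; exact pow_lt_one₀ (norm_nonneg q) hq1 (by norm_num)
  obtain ⟨c0, c1, c2⟩ := PartitionPairs.trisection_components (pow_ne_zero 3 hq0) h3
  have hmain := PartitionPairs.qPoch_mul_ST hζ0 hq0 hq1 h1 h2
  rw [(PartitionPairs.hasSum_trisect hζ hq0 hq1).tsum_eq] at hmain
  have htri := PartitionPairs.qPoch_self_trisect hq0 hq1
  refine mul_left_cancel₀ (PartitionPairs.qPoch_self_ne_zero hq1) ?_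
  rw [hmain, htri, PartitionPairs.A2]
  linear_combination c0 + q * c1 + q ^ 2 * c2
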